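/- Setting. Let $(M,d_M)$ be a compact metric space, $\nu$ a Borel probability measure on $M$ with full support, $A:M\times M\to\mathbb R$ continuous and $I\subset\mathbb R$ compact. Put $s(b)=\{a\in M: A(a,b)\in I\}$, $s^*(b)=\{a\in M:A(b,a)\in I\}$, $$\mathcal B=\{(x_1,x_2,\dots): A(x_n,x_{n+1})\in I\ \forall n\},\qquad \mathcal B^*=\{(\dots,y_2,y_1): A(y_{n+1},y_n)\in I\ \forall n\},$$ $$\widehat{\mathcal B}=\{(y|x)\in\mathcal B^*\times\mathcal B: A(y_1,x_1)\in I\},$$ with the shift $\sigma$ on $\mathcal B$ and the bilateral shift $\widehat\sigma(\dots,y_2,y_1|x_1,x_2,\dots)=(\dots,y_1,x_1|x_2,x_3,\dots)$ on $\widehat{\mathcal B}$. One-sided sequences carry the metric $\sum_n 2^{-n}d_M(x_n,x'_n)$, and $\widehat{\mathcal B}$ the sum of the two one-sided metrics; $\mathcal H_\alpha$ denotes the $\alpha$-Hölder functions, $\alpha>0$. Assume that $s$ and $s^*$ are locally constant, that $\mathcal B$ is non-empty and topologically transitive, and that every $y\in\mathcal B^*$ has an $x\in\mathcal B$ with $(y|x)\in\widehat{\mathcal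 B}$. For $\varphi\in\mathcal H_\alpha(\mathcal B)$ let $\mathcal L_\varphi\psi(x)=\int_{s(x_1)}e^{\varphi(ax)}\psi(ax)\,d\nu(a)$; let $\lambda_\varphi>0$ denote its maximal eigenvalue (simple, with a strictly positive eigenfunction $f_\varphi\in\mathcal H_\alpha(\mathcal B)$, and $|\kappa|\le\lambda_\varphi$ for every real eigenvalue $\kappa$ with a continuous eigenfunction), $\rho_\varphi$ a Borel probability measure with $\mathcal L_\varphi^*\rho_\varphi=\lambda_\varphi\rho_\varphi$, and $\mu_\varphi$ the Gibbs state, i.e. the probability measure fixed by $\mathcal L^*_{\overline\varphi}$, where $\overline\varphi=\varphi+\log f_\varphi-\log (f_\varphi\circ\sigma)-\log\lambda_\varphi$. For $\varphi^*\in\mathcal H_\alpha(\mathcal B^*)$ define $\mathcal L_{\varphi^*}\psi(y)=\int_{s^*(y_1)}e^{\varphi^*(ya)}\psi(ya)\,d\nu(a)$, $\lambda_{\varphi^*}$, $\rho_{\varphi^*}$, $\mu_{\varphi^*}$ in the same way on $\mathcal B^*$. Let $m(\varphi)=\sup\{\int\varphi\,d\mu:\mu\ \text{a }\sigma\text{-invariant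 Borel probability measure on }\mathcal B\}$. Theorem. Let $\varphi\in\mathcal H_\alpha(\mathcal B)$, $W\in\mathcal H_\alpha(\widehat{\mathcal B})$ and $\varphi^*\in\mathcal H_\alpha(\mathcal B^*)$ satisfy, for all $(y|x)\in\widehat{\mathcal B}$, $$\varphi^*(y)=\bigl(\widehat\varphi\circ\widehat\sigma^{-1}+W\circ\widehat\sigma^{-1}-W\bigr)(y|x),\qquad \widehat\varphi(y|x):=\varphi(x).$$ Then $\lambda,\rho,\mu$ as above exist for $\varphi$ and for $\varphi^*$. Moreover, for any eigenprobabilities $\rho_\varphi,\rho_{\varphi^*}$ as above, with $$c=\log\int {\bf 1}_I(A(y_1,x_1))\,e^{W(y|x)}\,d(\rho_{\varphi^*}\times\rho_\varphi)(y,x):$$ 1. The functions $$f(x)=\int{\bf 1}_I(A(y_1,x_1))e^{W(y|x)-c}\,d\rho_{\varphi^*}(y),\qquad f^*(y)=\int{\bf 1}_I(A(y_1,x_1))e^{W(y|x)-c}\,d\rho_{\varphi}(x)$$ are continuous and satisfy $\mathcal L_\varphi f=\lambda_\varphi f$, $\mathcal L_{\varphi^*}f^*=\lambda_{\varphi^*}f^*$,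 $\int f\,d\rho_\varphi=1=\int f^*\,d\rho_{\varphi^*}$, and $\lambda_\varphi=\lambda_{\varphi^*}$. 2. The measure $d\mu_{\widehat\varphi}={\bf 1}_I(A(y_1,x_1))\,e^{W-c}\,d(\rho_{\varphi^*}\times\rho_\varphi)$ is a probability measure on $\widehat{\mathcal B}$ and a natural extension of $\mu_\varphi$ and $\mu_{\varphi^*}$: $\int\psi(x)\,d\mu_{\widehat\varphi}(y|x)=\int\psi\,d\mu_\varphi$ for every continuous $\psi$ on $\mathcal B$, and $\int\psi^*(y)\,d\mu_{\widehat\varphi}(y|x)=\int\psi^*\,d\mu_{\varphi^*}$ for every continuous $\psi^*$ on $\mathcal B^*$. Furthermore, if for each $t>1$ the measure $\mu_{t\widehat\varphi}$ is built in this way from $t\varphi$, $t\varphi^*$ and $tW$, then every weak* accumulation point $\widehat\mu_\infty$ of $(\mu_{t\widehat\varphi})_{t>1}$ as $t\to\infty$ satisfies $\int\widehat\varphi\,d\widehat\mu_\infty=m(\varphi)$. -/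

import Mathlib

open MeasureTheory Filter Topology

noncomputable section

namespace InvolutionKernel

variable {M : Type*}

/-- The transposed map `(a, b) ↦ A(b, a)`. -/
abbrev transpose (A : M → M → ℝ) : M → M → ℝ := fun a b => A b a

/-- The one-sided subshift `B(A, I)` of admissible sequences. The entry `x n` is the entry
`x_{n+1}` of the usual notation `(x_1, x_2, …)`. The topology and the Borel sets are those
induced by the product `M^ℕ`.

The transposed subshift `B(A, I)^*`, consisting of the sequences `(…, y_2, y_1)` with
`A(y_{i+1}, y_i) ∈ I`, is `Adm (transpose A) I`, again with `y n` for `y_{n+1}`. -/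
abbrev Adm (A : M → M → ℝ) (I : Set ℝ) : Type _ :=
  {x : ℕ → M // ∀ n, A (x n) (x (n + 1)) ∈ I}

instance instSecondCountableAdm [TopologicalSpace M] [SecondCountableTopology M]
    (A : M → M → ℝ) (I : Set ℝ) : SecondCountableTopology (Adm A I) :=
  TopologicalSpace.Subtype.secondCountableTopology {x : ℕ → M | ∀ n, A (x n) (x (n + 1)) ∈ I}

/-- The section `s(b)` of `b` in `A⁻¹(I)`, the set of the `a` with `A(a, b) ∈ I`. For the
transposed map it is `s^*(b)`, the set of the `a` with `A(b, a) ∈ I`. -/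
def secSet (A : M → M → ℝ) (I : Set ℝ) (b : M) : Set M := {a | A a b ∈ I}

/-- The shift `(x_1, x_2, …) ↦ (x_2, x_3, …)`. -/
def shift {A : M → M → ℝ} {I : Set ℝ} (x : Adm A I) : Adm A I :=
  ⟨fun n => x.1 (n + 1), fun n => x.2 (n + 1)⟩

/-- The concatenation `(a, x_1, x_2, …)`, for `a ∈ s(x_1)`. -/
def cons {A : M → M → ℝ} {I : Set ℝ} (a : M) (x : Adm A I) (h : A a (x.1 0) ∈ I) : Adm A I :=
  ⟨fun n => Nat.casesOn n a x.1, fun n => by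
    cases n with
    | zero => exact h
    | succ k => exact x.2 k⟩

/-- Topological transitivity of the shift. -/
def IsTransitive [TopologicalSpace M] (A : M → M → ℝ) (I : Set ℝ) : Prop :=
  ∀ U V : Set (Adm A I), IsOpen U → IsOpen V → U.Nonempty → V.Nonempty →
    ∃ n : ℕ, 1 ≤ n ∧ ((shift^[n]) ⁻¹' U ∩ V).Nonempty

/-- The bilateral subshift: the pairs `(y | x)` with `A(y_1, x_1) ∈ I`. -/
abbrev Hat (A : M → M → ℝ) (I : Set ℝ) : Type _ :=
  {p : Adm (transpose A) I × Adm A I // A (p.1.1 0) (p.2.1 0) ∈ I}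

/-- The bilateral shift
`(…, y_2, y_1 | x_1, x_2, …) ↦ (…, y_1, x_1 | x_2, x_3, …)`, as a bijection. Its inverse is
`(…, y_2, y_1 | x_1, x_2, …) ↦ (…, y_3, y_2 | y_1, x_1, …)`. -/
def bishift (A : M → M → ℝ) (I : Set ℝ) : Hat A I ≃ Hat A I where
  toFun p := ⟨(cons (p.1.2.1 0) p.1.1 p.2, shift p.1.2), p.1.2.2 0⟩
  invFun p := ⟨(shift p.1.1, cons (p.1.1.1 0) p.1.2 p.2), p.1.1.2 0⟩
  left_inv p := by
    refine Subtype.ext (Prod.ext (Subtype.ext ?_) (Subtype.ext ?_))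
    · rfl
    · funext n
      cases n <;> rfl
  right_inv p := by
    refine Subtype.ext (Prod.ext (Subtype.ext ?_) (Subtype.ext ?_))
    · funext n
      cases n <;> rfl
    · rfl

/-- The distance `∑_{n ≥ 1} 2⁻ⁿ d_M(x_n, y_n)` on sequences. -/
def seqDist [MetricSpace M] {A : M → M → ℝ} {I : Set ℝ} (x y : Adm A I) : ℝ :=
  ∑' n : ℕ, (1 / 2 : ℝ) ^ (n + 1) * dist (x.1 n) (y.1 n)

/-- The distance on the bilateral subshift. -/
def hatDist [MetricSpace M] {A : M → M → ℝ} {I : Set ℝ} (p q : Hat A I) : ℝ :=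
  seqDist p.1.1 q.1.1 + seqDist p.1.2 q.1.2

/-- Hölder continuity with exponent `α` of a real function, for a given distance `d`. -/
def IsHolder {X : Type*} (d : X → X → ℝ) (α : ℝ) (g : X → ℝ) : Prop :=
  ∃ C : ℝ, ∀ x y, |g x - g y| ≤ C * d x y ^ α

/-- `W` is an involution kernel for `φ` with dual potential `φ'`: for every `(y | x)`,
`φ'(y) = (φ̂ ∘ σ̂⁻¹ + W ∘ σ̂⁻¹ - W)(y | x)`, where `φ̂(y | x) = φ(x)`. -/
def IsInvolutionKernel {A : M → M → ℝ} {I : Set ℝ} (φ : Adm A I → ℝ)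
    (φ' : Adm (transpose A) I → ℝ) (W : Hat A I → ℝ) : Prop :=
  ∀ p : Hat A I, φ' p.1.1 =
    φ ((bishift A I).symm p).1.2 + W ((bishift A I).symm p) - W p

/-- The Ruelle operator with a priori measure `ν`:
`(L_φ ψ)(x) = ∫_{s(x_1)} e^{φ(ax)} ψ(ax) dν(a)`. -/
def ruelle [MeasurableSpace M] {A : M → M → ℝ} {I : Set ℝ} (ν : Measure M)
    (φ ψ : Adm A I → ℝ) (x : Adm A I) : ℝ :=
  ∫ a : secSet A I (x.1 0), Real.exp (φ (cons a.1 x a.2)) * ψ (cons a.1 x a.2)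
    ∂(ν.comap Subtype.val)

/-- `L_φ g = κ g`. -/
def IsEigen [MeasurableSpace M] {A : M → M → ℝ} {I : Set ℝ} (ν : Measure M)
    (φ : Adm A I → ℝ) (κ : ℝ) (g : Adm A I → ℝ) : Prop :=
  ∀ x, ruelle ν φ g x = κ * g x

/-- `lam` is the maximal eigenvalue `λ_φ` of `L_φ`: it is positive, it has a strictly positive
Hölder eigenfunction, it is simple, and it dominates the other eigenvalues. -/
structure IsMaximalEigenvalue [MetricSpace M] [MeasurableSpace M] {A : M → M → ℝ} {I : Set ℝ}
    (ν : Measure M) (α : ℝ) (φ : Adm A I → ℝ) (lam : ℝ) : Prop where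
  pos : 0 < lam
  exists_eigenfunction : ∃ f : Adm A I → ℝ,
    IsHolder seqDist α f ∧ (∀ x, 0 < f x) ∧ IsEigen ν φ lam f
  simple : ∀ f g : Adm A I → ℝ, Continuous f → Continuous g → f ≠ 0 →
    IsEigen ν φ lam f → IsEigen ν φ lam g → ∃ r : ℝ, ∀ x, g x = r * f x
  maximal : ∀ (κ : ℝ) (g : Adm A I → ℝ), Continuous g → g ≠ 0 → IsEigen ν φ κ g → |κ| ≤ lam

/-- `ρ` is a probability measure with `L_φ^* ρ = lam ρ`, that is, `ρ(L_φ ψ) = lam ρ(ψ)` for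
every continuous `ψ`. -/
structure IsEigenprobability [TopologicalSpace M] [MeasurableSpace M] {A : M → M → ℝ}
    {I : Set ℝ} (ν : Measure M) (φ : Adm A I → ℝ) (lam : ℝ) (ρ : Measure (Adm A I)) : Prop where
  prob : IsProbabilityMeasure ρ
  eigen : ∀ ψ : C(Adm A I, ℝ), ∫ x, ruelle ν φ ψ x ∂ρ = lam * ∫ x, ψ x ∂ρ

/-- The normalized potential `φ + log f - log (f ∘ σ) - log lam`. -/
def normalized {A : M → M → ℝ} {I : Set ℝ} (φ f : Adm A I → ℝ) (lam : ℝ) (x : Adm A I) : ℝ :=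
  φ x + Real.log (f x) - Real.log (f (shift x)) - Real.log lam

/-- `μ` is the Gibbs state `μ_φ`: the probability measure that is fixed by the dual operator of
the normalized potential, built from `λ_φ` and a strictly positive Hölder eigenfunction. -/
structure IsGibbsState [MetricSpace M] [MeasurableSpace M] {A : M → M → ℝ} {I : Set ℝ}
    (ν : Measure M) (α : ℝ) (φ : Adm A I → ℝ) (μ : Measure (Adm A I)) : Prop where
  prob : IsProbabilityMeasure μ
  fixed : ∃ (lam : ℝ) (f : Adm A I → ℝ), IsMaximalEigenvalue ν α φ lam ∧
    IsHolder seqDist α f ∧ (∀ x, 0 < f x) ∧ IsEigen ν φ lam f ∧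
    ∀ ψ : C(Adm A I, ℝ), ∫ x, ruelle ν (normalized φ f lam) ψ x ∂μ = ∫ x, ψ x ∂μ

open Classical in
/-- The function `(1_I ∘ A ∘ π_{1,1}) e^W` on the product `B(A, I)^* × B(A, I)`. -/
def expKernel {A : M → M → ℝ} {I : Set ℝ} (W : Hat A I → ℝ)
    (y : Adm (transpose A) I) (x : Adm A I) : ℝ :=
  if h : A (y.1 0) (x.1 0) ∈ I then Real.exp (W ⟨(y, x), h⟩) else 0

variable [MeasurableSpace M] {A : M → M → ℝ} {I : Set ℝ}

/-- The constant `c = log ((ρ' × ρ)((1_I ∘ A ∘ π_{1,1}) e^W))`. -/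
def logConst (W : Hat A I → ℝ) (ρ' : Measure (Adm (transpose A) I)) (ρ : Measure (Adm A I)) : ℝ :=
  Real.log (∫ p, expKernel W p.1 p.2 ∂(ρ'.prod ρ))

/-- `f(x) = ∫ 1_I(A(y_1, x_1)) e^{W(y|x) - c} dρ'(y)`. -/
def eigenfun (W : Hat A I → ℝ) (ρ' : Measure (Adm (transpose A) I)) (ρ : Measure (Adm A I))
    (x : Adm A I) : ℝ :=
  ∫ y, expKernel (fun p => W p - logConst W ρ' ρ) y x ∂ρ'

/-- `f^*(y) = ∫ 1_I(A(y_1, x_1)) e^{W(y|x) - c} dρ(x)`. -/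
def eigenfunStar (W : Hat A I → ℝ) (ρ' : Measure (Adm (transpose A) I)) (ρ : Measure (Adm A I))
    (y : Adm (transpose A) I) : ℝ :=
  ∫ x, expKernel (fun p => W p - logConst W ρ' ρ) y x ∂ρ

/-- The measure `(1_I ∘ A ∘ π_{1,1}) e^{W - c} d(ρ' × ρ)`, as a measure on the bilateral
subshift. -/
def bilateralMeasure (W : Hat A I → ℝ) (ρ' : Measure (Adm (transpose A) I))
    (ρ : Measure (Adm A I)) : Measure (Hat A I) :=
  ((ρ'.prod ρ).comap Subtype.val).withDensity
    (fun p => ENNReal.ofReal (Real.exp (W p - logConst W ρ' ρ)))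

/-- `m` is the bilateral measure built from `W` and from eigenprobabilities of `L_φ` and
`L_{φ'}` for their maximal eigenvalues. -/
def IsBilateralGibbs [MetricSpace M] (ν : Measure M) (α : ℝ) (φ : Adm A I → ℝ)
    (φ' : Adm (transpose A) I → ℝ) (W : Hat A I → ℝ) (m : Measure (Hat A I)) : Prop :=
  ∃ (lam lam' : ℝ) (ρ : Measure (Adm A I)) (ρ' : Measure (Adm (transpose A) I)),
    IsMaximalEigenvalue ν α φ lam ∧ IsMaximalEigenvalue ν α φ' lam' ∧
    IsEigenprobability ν φ lam ρ ∧ IsEigenprobability ν φ' lam' ρ' ∧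
    m = bilateralMeasure W ρ' ρ

/-- The integrals of `φ` against the shift-invariant probability measures; `m(φ)` is the
supremum of this set. -/
def invariantIntegrals (φ : Adm A I → ℝ) : Set ℝ :=
  {r | ∃ μ : Measure (Adm A I), IsProbabilityMeasure μ ∧ MeasurePreserving shift μ μ ∧
    r = ∫ x, φ x ∂μ}

end InvolutionKernel

end

/-!
The proof has three parts: a Perron–Frobenius theorem for the Ruelle operators on both subshifts,
the duality between them that the involution kernel provides, and the zero temperature limit.

**Perron–Frobenius.** Since `s` and `s^*` are locally constant, admissibility is a clopen relation,
`L_φ` acts on `C(B)`, and transitivity makes it irreducible: at every point some iterate of a given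
non-zero `u ≥ 0` is positive, because the iterated preimages of every point are dense
(`IsTransitive.isIrreducibleSubshift`). Reading paths backwards gives the same for `B^*`
(`IsIrreducibleSubshift.transpose`). Prepending a symbol halves distances, so that `L_φ` preserves
a cone of functions whose logarithm has a prescribed local modulus of continuity
(`isCompactInvariantCone_logCone`), and by Arzelà–Ascoli bounded parts of this cone are compact. In
such a cone the Collatz–Wielandt extremal problem has a solution, which irreducibility turns into a
positive eigenfunction (`IsIrreducible.exists_eigenfunction`). Simplicity and maximality of the
eigenvalue follow from the comparison of ratios of eigenfunctions. Eigenmeasures are limits of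
Cesàro averages (`IsIrreducible.exists_eigenprobability`); they are unique up to normalization
because the averages of any continuous function accumulate only at multiples of the eigenfunction
(`eigenfunctional_unique`), and so the Gibbs state is `f ρ_φ` whichever eigenprobability is used
(`IsGibbsState.integral_eq`).

**Duality.** In multiplicative form, the cohomological equation says that the kernel `K(y, x) =
1_I(A(y_1, x_1)) e^{W(y|x)}` satisfies `e^{φ(ax)} K(y, ax) = e^{φ^*(ya)} K(ya, x)`. By Fubini,
integrating `K` against an eigenmeasure of one Ruelle operator gives an eigenfunction of the other
one with the same eigenvalue (`isEigen_integral_kernel`). It is positive since eigenmeasures have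
full support. Pairing `f` with `ρ_φ` shows `λ_φ = λ_{φ^*}`, and the marginals of the bilateral
measure are `f ρ_φ` and `f^* ρ_{φ^*}` (`bilateral_eigenfunctions`).

**Zero temperature.** Write `P(t) = log λ_{tφ}` and `m_t = μ_{t φ̂}`. The inequality `e^h ≥ 1 + h`
gives the tangent inequality `P(t) + (1 - t) ∫ φ̂ dm_t ≤ P(1)` (`log_add_integral_le_log`). On the
other hand the logarithm of the eigenfunction at `t` has local Hölder constant `O(t)`, and
restricting the integral in `L_{tφ} f = λ f` to small balls, whose `ν`-measure is bounded below,
gives `P(t) ≥ t (∫ φ dμ - κ) - b_κ` for every invariant `μ` and every `κ > 0`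
(`exists_integral_le_log_add`). So `∫ φ̂ dm_t` is asymptotically at least `∫ φ dμ`. No entropy is
needed, nor a bound on the global oscillation of the eigenfunctions. Accumulation points of `m_t`
have an invariant marginal on `B`, hence their integral of `φ̂` is itself one of those over which
the supremum is taken.
-/


namespace InvolutionKernel

/-! ### Irreducible positive operators on `C(X)` -/

section PositiveOperators

variable {X : Type*} [TopologicalSpace X] [CompactSpace X] {L : C(X, ℝ) →L[ℝ] C(X, ℝ)}

/-- A positive operator on `C(X)` is irreducible if some iterate of every non-zero `u ≥ 0` is
positive at any given point. Strict positivity of `L 1` excludes the zero operator on a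
one-point space, since `n = 0` is allowed in `exists_pos`. -/
structure IsIrreducible (L : C(X, ℝ) →L[ℝ] C(X, ℝ)) : Prop where
  map_nonneg : ∀ u : C(X, ℝ), (∀ x, 0 ≤ u x) → ∀ x, 0 ≤ L u x
  exists_pos : ∀ u : C(X, ℝ), (∀ x, 0 ≤ u x) → u ≠ 0 → ∀ x, ∃ n : ℕ, 0 < (L ^ n) u x
  map_one_pos : ∀ x, 0 < L 1 x

/-- A convex cone of non-negative functions that is invariant under `L` and whose bounded parts
are compact in the uniform norm. -/
structure IsCompactInvariantCone (L : C(X, ℝ) →L[ℝ] C(X, ℝ)) (K : Set C(X, ℝ)) : Prop where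
  nonneg : ∀ u ∈ K, ∀ x, 0 ≤ u x
  add_mem : ∀ u ∈ K, ∀ v ∈ K, u + v ∈ K
  smul_mem : ∀ c : ℝ, 0 ≤ c → ∀ u ∈ K, c • u ∈ K
  map_mem : ∀ u ∈ K, L u ∈ K
  isCompact : ∀ R : ℝ, IsCompact {u | u ∈ K ∧ ‖u‖ ≤ R}

lemma pow_succ_apply_comm (L : C(X, ℝ) →L[ℝ] C(X, ℝ)) (n : ℕ) (u : C(X, ℝ)) :
    (L ^ (n + 1)) u = L ((L ^ n) u) := by
  rw [pow_succ']; rfl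

lemma pow_apply_eigen {κ : ℝ} {u : C(X, ℝ)} (h : L u = κ • u) (n : ℕ) :
    (L ^ n) u = κ ^ n • u := by
  induction n with
  | zero => simp
  | succ n ih => rw [pow_succ_apply_comm, ih, map_smul, h, smul_smul, pow_succ]

namespace IsIrreducible

variable (hL : IsIrreducible L)
include hL

lemma monotone {u v : C(X, ℝ)} (h : ∀ x, u x ≤ v x) (x : X) : L u x ≤ L v x := by
  have := hL.map_nonneg (v - u) (fun x => by simpa using h x) x
  simpa using this

lemma pow_nonneg {u : C(X, ℝ)} (h : ∀ x, 0 ≤ u x) (n : ℕ) : ∀ x, 0 ≤ (L ^ n) u x := by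
  induction n with
  | zero => simpa using h
  | succ n ih => rw [pow_succ_apply_comm]; exact hL.map_nonneg _ ih

lemma pow_monotone {u v : C(X, ℝ)} (h : ∀ x, u x ≤ v x) (n : ℕ) (x : X) :
    (L ^ n) u x ≤ (L ^ n) v x := by
  have := hL.pow_nonneg (u := v - u) (fun x => by simpa using h x) n x
  simpa using this

lemma eigenfunction_pos {κ : ℝ} {u : C(X, ℝ)} (h0 : ∀ x, 0 ≤ u x) (hu : u ≠ 0)
    (h : L u = κ • u) (x : X) : 0 < u x := by
  obtain ⟨n, hn⟩ := hL.exists_pos u h0 hu x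
  rw [pow_apply_eigen h] at hn
  refine lt_of_le_of_ne (h0 x) fun h => ?_
  simp [← h] at hn

/-- Eigenvalues of irreducible operators with a positive eigenfunction are simple: for the
largest ratio `C = g x₀ / f x₀`, the function `C f - g` is a non-negative eigenfunction that
vanishes at `x₀`. -/
lemma eigenfunction_unique [Nonempty X] {lam : ℝ} {f g : C(X, ℝ)} (hf : ∀ x, 0 < f x)
    (hfL : L f = lam • f) (hg : L g = lam • g) : ∃ r : ℝ, g = r • f := by
  obtain ⟨x₀, -, hx₀⟩ := isCompact_univ.exists_isMaxOn (f := fun x => g x / f x)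
    Set.univ_nonempty (g.continuous.div f.continuous fun x => (hf x).ne').continuousOn
  refine ⟨g x₀ / f x₀, ?_⟩
  by_contra hne
  have := hL.eigenfunction_pos (κ := lam) (u := (g x₀ / f x₀) • f - g) (fun x => ?_) ?_ ?_ x₀
  · simp [(hf x₀).ne'] at this
  · have h : g x / f x ≤ g x₀ / f x₀ := hx₀ (Set.mem_univ x)
    rw [div_le_iff₀ (hf x)] at h
    simpa using h
  · exact fun h => hne (sub_eq_zero.1 h).symm
  · rw [map_sub, map_smul, hfL, hg, smul_sub, smul_comm]

lemma abs_eigenvalue_le [Nonempty X] {lam κ : ℝ} {f g : C(X, ℝ)} (hf : ∀ x, 0 < f x)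
    (hfL : L f = lam • f) (hg : L g = κ • g) (hg0 : g ≠ 0) : |κ| ≤ lam := by
  obtain ⟨x₀, -, hx₀⟩ := isCompact_univ.exists_isMaxOn (f := fun x => |g x| / f x)
    Set.univ_nonempty (g.continuous.abs.div f.continuous fun x => (hf x).ne').continuousOn
  have hle : ∀ x, |g x| ≤ (|g x₀| / f x₀) * f x := fun x => by
    have h : |g x| / f x ≤ |g x₀| / f x₀ := hx₀ (Set.mem_univ x)
    rwa [div_le_iff₀ (hf x)] at h
  have hpos : 0 < |g x₀| := by
    refine lt_of_le_of_ne (abs_nonneg _) fun h => hg0 ?_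
    ext x
    have := hle x
    rw [← h] at this
    simpa using this
  have h1 := hL.monotone (u := g) (v := (|g x₀| / f x₀) • f)
    (fun x => by simpa using (le_abs_self _).trans (hle x)) x₀
  have h2 := hL.monotone (u := -g) (v := (|g x₀| / f x₀) • f)
    (fun x => by simpa using (neg_le_abs _).trans (hle x)) x₀
  rw [map_smul, hfL] at h1 h2
  rw [map_neg, hg] at h2
  rw [hg] at h1
  simp only [ContinuousMap.smul_apply, ContinuousMap.neg_apply, smul_eq_mul] at h1 h2
  have e : |g x₀| / f x₀ * (lam * f x₀) = lam * |g x₀| := by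
    field_simp [(hf x₀).ne']
  rw [e] at h1 h2
  have : |κ| * |g x₀| ≤ lam * |g x₀| := by
    rw [← abs_mul]; exact abs_le'.2 ⟨h1, h2⟩
  exact le_of_mul_le_mul_right this hpos

lemma exists_sum_pow_pos {w : C(X, ℝ)} (h0 : ∀ x, 0 ≤ w x) (hw : w ≠ 0) :
    ∃ N : ℕ, ∀ x, 0 < ∑ k ∈ Finset.range N, (L ^ k) w x := by
  have hcont : ∀ N : ℕ, Continuous fun x => ∑ k ∈ Finset.range N, (L ^ k) w x := fun N =>
    continuous_finsetSum _ fun k _ => ((L ^ k) w).continuous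
  have hcover : Set.univ ⊆ ⋃ N : ℕ, {x | 0 < ∑ k ∈ Finset.range N, (L ^ k) w x} := fun x _ => by
    obtain ⟨n, hn⟩ := hL.exists_pos w h0 hw x
    refine Set.mem_iUnion.2 ⟨n + 1, ?_⟩
    exact Finset.sum_pos' (fun k _ => hL.pow_nonneg h0 k x) ⟨n, by simp, hn⟩
  have hdir : Directed (· ⊆ ·) fun N : ℕ => {x | 0 < ∑ k ∈ Finset.range N, (L ^ k) w x} :=
    Monotone.directed_le fun a b hab x hx => lt_of_lt_of_le hx
      (Finset.sum_le_sum_of_subset_of_nonneg (by simpa using hab)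
        fun k _ _ => hL.pow_nonneg h0 k x)
  obtain ⟨N, hN⟩ := isCompact_univ.elim_directed_cover _
    (fun N => isOpen_lt continuous_const (hcont N)) hcover hdir
  exact ⟨N, fun x => hN (Set.mem_univ x)⟩

/-- Existence of a positive eigenfunction in an invariant cone with compact bounded parts. The
eigenvalue is the largest `r` with `r u ≤ L u` for some `u` in the cone of norm one
(Collatz–Wielandt). If the inequality were strict somewhere for a maximizer `u`, then a sum of
iterates of `u` would satisfy it strictly everywhere, with room for a larger `r`. -/
theorem exists_eigenfunction [Nonempty X] {K : Set C(X, ℝ)} (hK : IsCompactInvariantCone L K)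
    (h1 : 1 ∈ K) : ∃ lam : ℝ, 0 < lam ∧ ∃ f ∈ K, (∀ x, 0 < f x) ∧ L f = lam • f := by
  have hbound : ∀ (r : ℝ) (u : C(X, ℝ)), 0 ≤ r → (∀ x, 0 ≤ u x) → 0 < ‖u‖ →
      (∀ x, r * u x ≤ L u x) → r ≤ ‖L‖ := fun r u hr h0 hu h => by
    have : ‖r • u‖ ≤ ‖L u‖ := by
      refine (ContinuousMap.norm_le _ (norm_nonneg _)).2 fun x => ?_
      have h2 : ‖(r • u) x‖ = r * u x := by
        simp [abs_of_nonneg hr, abs_of_nonneg (h0 x)]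
      rw [h2]
      exact (h x).trans ((le_abs_self _).trans ((L u).norm_coe_le_norm x))
    rw [norm_smul, Real.norm_of_nonneg hr] at this
    exact le_of_mul_le_mul_right (this.trans (L.le_opNorm u)) hu
  set S : Set (ℝ × C(X, ℝ)) := (Set.Icc 0 ‖L‖ ×ˢ {u | u ∈ K ∧ ‖u‖ ≤ 1}) ∩
    ({p | ‖p.2‖ = 1} ∩ {p | ∀ x, p.1 * p.2 x ≤ L p.2 x}) with hS
  have hSc : IsCompact S := by
    refine (isCompact_Icc.prod (hK.isCompact 1)).inter_right
      ((isClosed_eq (by fun_prop) (by fun_prop)).inter ?_)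
    simp only [Set.ofPred_forall]
    refine isClosed_iInter fun x => isClosed_le ?_ ?_
    · exact continuous_fst.mul ((continuous_eval_const x).comp continuous_snd)
    · exact (continuous_eval_const x).comp (L.continuous.comp continuous_snd)
  have hSne : S.Nonempty := by
    refine ⟨(0, 1), ⟨⟨le_rfl, norm_nonneg L⟩, h1, by simp⟩, by simp, fun x => ?_⟩
    simpa using (hL.map_one_pos x).le
  obtain ⟨⟨r, u⟩, ⟨⟨⟨hr0, -⟩, huK, -⟩, hu1, hru⟩, hmax⟩ :=
    hSc.exists_isMaxOn hSne continuous_fst.continuousOn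
  simp only [Set.mem_ofPred_eq] at hr0 huK hu1 hru
  have hu0 := hK.nonneg u huK
  have hune : u ≠ 0 := by rintro rfl; simp at hu1
  have heig : L u = r • u := by
    by_contra hne
    obtain ⟨N, hN⟩ := hL.exists_sum_pow_pos (w := L u - r • u)
      (fun x => by simpa using hru x) (sub_ne_zero.2 hne)
    obtain ⟨x₁, -, hx₁⟩ := isCompact_univ.exists_isMinOn Set.univ_nonempty
      (continuous_finsetSum (Finset.range N)
        fun k _ => ((L ^ k) (L u - r • u)).continuous).continuousOn
    set δ := ∑ k ∈ Finset.range N, (L ^ k) (L u - r • u) x₁ with hδ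
    have hδ0 : 0 < δ := hN x₁
    have hNpos : 0 < N := by
      rcases Nat.eq_zero_or_pos N with rfl | h
      · simp at hδ; linarith
      · exact h
    set v : C(X, ℝ) := ∑ k ∈ Finset.range N, (L ^ k) u with hv
    have hpowK : ∀ k : ℕ, (L ^ k) u ∈ K := fun k => by
      induction k with
      | zero => simpa using huK
      | succ k ih => rw [pow_succ_apply_comm]; exact hK.map_mem _ ih
    have hvK : v ∈ K := by
      refine Finset.sum_induction _ (· ∈ K) (fun a b ha hb => hK.add_mem a ha b hb) ?_
        fun k _ => hpowK k
      simpa using hK.smul_mem 0 le_rfl 1 h1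
    have hvu : ∀ x, u x ≤ v x := fun x => by
      have : (L ^ 0) u x ≤ ∑ k ∈ Finset.range N, (L ^ k) u x :=
        Finset.single_le_sum (f := fun k => (L ^ k) u x)
          (fun k _ => hL.pow_nonneg hu0 k x) (Finset.mem_range.2 hNpos)
      simpa [hv] using this
    have hvne : v ≠ 0 := by
      intro h
      refine hune (ContinuousMap.ext fun x => le_antisymm ?_ (hu0 x))
      simpa [h] using hvu x
    have hvn : 0 < ‖v‖ := norm_pos_iff.2 hvne
    have hLv : ∀ x, L v x - r * v x = ∑ k ∈ Finset.range N, (L ^ k) (L u - r • u) x := by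
      intro x
      have hcomm : ∀ k : ℕ, (L ^ k) (L u) = L ((L ^ k) u) := fun k => by
        rw [← pow_succ_apply_comm, pow_succ]; rfl
      simp only [hv, map_sum, map_sub, map_smul, hcomm, ContinuousMap.sum_apply,
        ContinuousMap.sub_apply, ContinuousMap.smul_apply, smul_eq_mul, Finset.sum_sub_distrib,
        Finset.mul_sum]
    have himp : ∀ x, (r + δ / ‖v‖) * v x ≤ L v x := fun x => by
      have h2 : δ ≤ L v x - r * v x := by rw [hLv]; exact hx₁ (Set.mem_univ x)
      have h3 : v x ≤ ‖v‖ := (le_abs_self _).trans (v.norm_coe_le_norm x)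
      have h4 : δ / ‖v‖ * v x ≤ δ := by
        rw [div_mul_eq_mul_div, div_le_iff₀ hvn]
        exact mul_le_mul_of_nonneg_left h3 hδ0.le
      linarith
    have hr' : 0 ≤ r + δ / ‖v‖ := by positivity
    have hmem : (r + δ / ‖v‖, ‖v‖⁻¹ • v) ∈ S := by
      have hn : ‖‖v‖⁻¹ • v‖ = 1 := by
        rw [norm_smul, norm_inv, norm_norm, inv_mul_cancel₀ hvn.ne']
      refine ⟨⟨⟨hr', hbound _ v hr' (hK.nonneg v hvK) hvn himp⟩,
        hK.smul_mem _ (by positivity) _ hvK, hn.le⟩, hn, fun x => ?_⟩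
      have := mul_le_mul_of_nonneg_left (himp x) (inv_nonneg.2 hvn.le)
      simp only [map_smul, ContinuousMap.smul_apply, smul_eq_mul]
      linarith
    have h5 : r + δ / ‖v‖ ≤ r := hmax hmem
    have : 0 < δ / ‖v‖ := by positivity
    linarith
  have hupos := hL.eigenfunction_pos hu0 hune heig
  refine ⟨r, lt_of_le_of_ne hr0 fun h => ?_, u, huK, hupos, heig⟩
  obtain ⟨x₁, -, hx₁⟩ := isCompact_univ.exists_isMinOn Set.univ_nonempty u.continuous.continuousOn
  have h2 := hL.monotone (u := u x₁ • 1) (v := u)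
    (fun x => by simpa using hx₁ (Set.mem_univ x)) x₁
  rw [heig, ← h] at h2
  have := mul_pos (hupos x₁) (hL.map_one_pos x₁)
  simp only [map_smul, ContinuousMap.smul_apply, smul_eq_mul, zero_mul] at h2
  linarith

end IsIrreducible

end PositiveOperators

/-! ### Averages of the iterates and eigenmeasures -/

section CesaroAverages

variable {X : Type*} [TopologicalSpace X] [CompactSpace X] {L : C(X, ℝ) →L[ℝ] C(X, ℝ)}

/-- The Cesàro averages of the iterates of `lam⁻¹ L`. -/
noncomputable def cesaro (L : C(X, ℝ) →L[ℝ] C(X, ℝ)) (lam : ℝ) (n : ℕ) :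
    C(X, ℝ) →L[ℝ] C(X, ℝ) :=
  ((n : ℝ) + 1)⁻¹ • ∑ k ∈ Finset.range (n + 1), (lam⁻¹) ^ k • L ^ k

lemma cesaro_apply (lam : ℝ) (n : ℕ) (u : C(X, ℝ)) :
    cesaro L lam n u = ((n : ℝ) + 1)⁻¹ • ∑ k ∈ Finset.range (n + 1), (lam⁻¹) ^ k • (L ^ k) u := by
  simp [cesaro]

lemma cesaro_eigen {lam : ℝ} (hlam : 0 < lam) {f : C(X, ℝ)} (hf : L f = lam • f) (n : ℕ) :
    cesaro L lam n f = f := by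
  have h : ∀ k : ℕ, (lam⁻¹) ^ k • (L ^ k) f = f := fun k => by
    rw [pow_apply_eigen hf, smul_smul, ← mul_pow, inv_mul_cancel₀ hlam.ne', one_pow, one_smul]
  rw [cesaro_apply, Finset.sum_congr rfl fun k _ => h k, Finset.sum_const, Finset.card_range,
    ← Nat.cast_smul_eq_nsmul ℝ, smul_smul]
  push_cast
  rw [inv_mul_cancel₀ (by positivity), one_smul]

/-- The averages are almost eigenfunctions, because the sum telescopes. -/
lemma map_cesaro_sub {lam : ℝ} (n : ℕ) (u : C(X, ℝ)) :
    lam⁻¹ • L (cesaro L lam n u) - cesaro L lam n u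
      = ((n : ℝ) + 1)⁻¹ • ((lam⁻¹) ^ (n + 1) • (L ^ (n + 1)) u - u) := by
  have h := Finset.sum_range_sub (fun k => (lam⁻¹) ^ k • (L ^ k) u) (n + 1)
  simp only [pow_zero, one_smul, one_apply_eq_self] at h
  rw [← h, Finset.sum_sub_distrib, cesaro_apply, smul_sub, map_smul, map_sum, smul_comm,
    Finset.smul_sum (r := lam⁻¹)]
  congr 2
  refine Finset.sum_congr rfl fun k _ => ?_
  rw [map_smul, smul_smul, pow_succ_apply_comm, pow_succ']

lemma cesaro_map {lam : ℝ} (n : ℕ) (u : C(X, ℝ)) :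
    cesaro L lam n (L u) = L (cesaro L lam n u) := by
  have hcomm : ∀ k : ℕ, (L ^ k) (L u) = L ((L ^ k) u) := fun k => by
    rw [← pow_succ_apply_comm, pow_succ]; rfl
  simp [cesaro_apply, hcomm]

namespace IsIrreducible

variable (hL : IsIrreducible L) {lam : ℝ} (hlam : 0 < lam) {f : C(X, ℝ)}
  (hf : ∀ x, 0 < f x) (hfL : L f = lam • f)
include hL hlam hf hfL

omit hL hlam hfL in
lemma exists_abs_le [Nonempty X] (u : C(X, ℝ)) : ∃ C, 0 ≤ C ∧ ∀ x, |u x| ≤ C * f x := by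
  obtain ⟨x₀, -, hx₀⟩ := isCompact_univ.exists_isMaxOn (f := fun x => |u x| / f x)
    Set.univ_nonempty (u.continuous.abs.div f.continuous fun x => (hf x).ne').continuousOn
  refine ⟨|u x₀| / f x₀, div_nonneg (abs_nonneg _) (hf x₀).le, fun x => ?_⟩
  have h : |u x| / f x ≤ |u x₀| / f x₀ := hx₀ (Set.mem_univ x)
  rwa [div_le_iff₀ (hf x)] at h

omit hf in
lemma abs_pow_le {u : C(X, ℝ)} {C : ℝ} (h : ∀ x, |u x| ≤ C * f x) (k : ℕ) (x : X) :
    |(lam⁻¹ ^ k • (L ^ k) u) x| ≤ C * f x := by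
  have e : lam⁻¹ ^ k * (C * (lam ^ k * f x)) = C * f x := by
    rw [inv_pow]; field_simp
  have h1 := hL.pow_monotone (u := u) (v := C • f)
    (fun x => by simpa using (le_abs_self _).trans (h x)) k x
  have h2 := hL.pow_monotone (u := -u) (v := C • f)
    (fun x => by simpa using (neg_le_abs _).trans (h x)) k x
  rw [map_smul, pow_apply_eigen hfL] at h1 h2
  simp only [map_neg, ContinuousMap.smul_apply, ContinuousMap.neg_apply, smul_eq_mul] at h1 h2 ⊢
  have hp : 0 ≤ lam⁻¹ ^ k := by positivity
  rw [abs_mul, abs_of_nonneg hp, ← e]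
  exact mul_le_mul_of_nonneg_left (abs_le'.2 ⟨h1, h2⟩) hp

omit hf in
lemma abs_cesaro_le {u : C(X, ℝ)} {C : ℝ} (h : ∀ x, |u x| ≤ C * f x) (n : ℕ) (x : X) :
    |cesaro L lam n u x| ≤ C * f x := by
  rw [cesaro_apply, ContinuousMap.smul_apply, smul_eq_mul, ContinuousMap.sum_apply, abs_mul,
    abs_of_pos (show (0 : ℝ) < ((n : ℝ) + 1)⁻¹ by positivity), inv_mul_le_iff₀ (by positivity)]
  refine (Finset.abs_sum_le_sum_abs _ _).trans
    ((Finset.sum_le_sum fun k _ => hL.abs_pow_le hlam hfL h k x).trans_eq ?_)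
  simp

lemma tendsto_map_cesaro_sub [Nonempty X] (u : C(X, ℝ)) :
    Tendsto (fun n => lam⁻¹ • L (cesaro L lam n u) - cesaro L lam n u) atTop (𝓝 0) := by
  obtain ⟨C, hC, h⟩ := exists_abs_le hf u
  refine squeeze_zero_norm (a := fun n : ℕ => ((n : ℝ) + 1)⁻¹ * (C * ‖f‖ + ‖u‖)) (fun n => ?_) ?_
  · rw [map_cesaro_sub, norm_smul, Real.norm_of_nonneg (by positivity)]
    refine mul_le_mul_of_nonneg_left ((norm_sub_le _ _).trans ?_) (by positivity)
    gcongr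
    refine (ContinuousMap.norm_le _ (by positivity)).2 fun x => ?_
    refine (hL.abs_pow_le hlam hfL h (n + 1) x).trans ?_
    exact mul_le_mul_of_nonneg_left ((le_abs_self _).trans (f.norm_coe_le_norm x)) hC
  · have := (tendsto_one_div_add_atTop_nhds_zero_nat (𝕜 := ℝ)).mul_const (C * ‖f‖ + ‖u‖)
    simpa using this

/-- A function `u` in a compact invariant cone has the same integral, up to the normalization
`ℓ f = 1`, under all eigenfunctionals: the averages of `u` accumulate at an eigenfunction, that
is, at a multiple of `f`. -/
theorem exists_eigenfunctional_apply_eq [Nonempty X] {K : Set C(X, ℝ)}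
    (hK : IsCompactInvariantCone L K) {u : C(X, ℝ)} (hu : u ∈ K) :
    ∃ r : ℝ, ∀ ℓ : C(X, ℝ) →L[ℝ] ℝ, (∀ ψ, ℓ (L ψ) = lam * ℓ ψ) → ℓ u = r * ℓ f := by
  obtain ⟨C, hC, h⟩ := exists_abs_le hf u
  have hpowK : ∀ k : ℕ, (L ^ k) u ∈ K := fun k => by
    induction k with
    | zero => simpa using hu
    | succ k ih => rw [pow_succ_apply_comm]; exact hK.map_mem _ ih
  have hmem : ∀ n, cesaro L lam n u ∈ {v | v ∈ K ∧ ‖v‖ ≤ C * ‖f‖} := fun n => by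
    refine ⟨?_, (ContinuousMap.norm_le _ (by positivity)).2 fun x => ?_⟩
    · rw [cesaro_apply]
      refine hK.smul_mem _ (by positivity) _ (Finset.sum_induction _ (· ∈ K)
        (fun a b ha hb => hK.add_mem a ha b hb) ?_ fun k _ =>
          hK.smul_mem _ (by positivity) _ (hpowK k))
      simpa using hK.smul_mem 0 le_rfl u hu
    · exact (hL.abs_cesaro_le hlam hfL h n x).trans
        (mul_le_mul_of_nonneg_left ((le_abs_self _).trans (f.norm_coe_le_norm x)) hC)
  obtain ⟨v, -, s, hs, hv⟩ := (hK.isCompact _).tendsto_subseq hmem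
  have hlim : Tendsto (fun n => lam⁻¹ • L (cesaro L lam (s n) u) - cesaro L lam (s n) u) atTop
      (𝓝 (lam⁻¹ • L v - v)) :=
    (((L.continuous.tendsto v).comp hv).const_smul lam⁻¹).sub hv
  have hLv : L v = lam • v := by
    have h0 := tendsto_nhds_unique hlim
      ((hL.tendsto_map_cesaro_sub hlam hf hfL u).comp hs.tendsto_atTop)
    rw [← sub_eq_zero.1 h0, smul_smul, mul_inv_cancel₀ hlam.ne', one_smul]
    rw [sub_eq_zero.1 h0]
  obtain ⟨r, rfl⟩ := hL.eigenfunction_unique hf hfL hLv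
  refine ⟨r, fun ℓ hℓ => ?_⟩
  have hpow : ∀ k : ℕ, lam⁻¹ ^ k * ℓ ((L ^ k) u) = ℓ u := fun k => by
    induction k with
    | zero => simp
    | succ k ih =>
      rw [pow_succ_apply_comm, hℓ, ← ih, pow_succ]
      field_simp
  have hces : ∀ n, ℓ (cesaro L lam n u) = ℓ u := fun n => by
    simp only [cesaro_apply, map_smul, map_sum, smul_eq_mul, hpow, Finset.sum_const,
      Finset.card_range, nsmul_eq_mul]
    push_cast
    field_simp
  have h1 : Tendsto (fun n => ℓ (cesaro L lam (s n) u)) atTop (𝓝 (ℓ (r • f))) :=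
    (ℓ.continuous.tendsto _).comp hv
  simp only [hces] at h1
  simpa using tendsto_nhds_unique tendsto_const_nhds h1

/-- A positive eigenvector of the dual operator: the limit of the averages at a point along
an ultrafilter. -/
theorem exists_eigenfunctional [Nonempty X] :
    ∃ ℓ : C(X, ℝ) →ₗ[ℝ] ℝ, (∀ u : C(X, ℝ), (∀ x, 0 ≤ u x) → 0 ≤ ℓ u) ∧ 0 < ℓ f ∧
      ∀ u, ℓ (L u) = lam * ℓ u := by
  obtain ⟨x₀⟩ := ‹Nonempty X›
  have : Nonempty X := ⟨x₀⟩
  let U : Ultrafilter ℕ := Filter.hyperfilter ℕ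
  have hU : (U : Filter ℕ) ≤ atTop := Nat.hyperfilter_le_atTop
  have hex : ∀ u : C(X, ℝ), ∃ a : ℝ, Tendsto (fun n => cesaro L lam n u x₀) U (𝓝 a) := fun u => by
    obtain ⟨C, hC, h⟩ := exists_abs_le hf u
    obtain ⟨a, -, ha⟩ := (isCompact_Icc (a := -(C * f x₀)) (b := C * f x₀)).ultrafilter_le_nhds
      (U.map fun n => cesaro L lam n u x₀) (by
        rw [le_principal_iff]
        exact Filter.Eventually.of_forall (f := (U : Filter ℕ)) fun n =>
          abs_le.1 (hL.abs_cesaro_le hlam hfL h n x₀))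
    exact ⟨a, ha⟩
  choose ℓ hℓ using hex
  refine ⟨⟨⟨ℓ, fun u v => ?_⟩, fun c u => ?_⟩, fun u hu => ?_, ?_, fun u => ?_⟩
  · refine tendsto_nhds_unique (hℓ (u + v)) ?_
    simpa using (hℓ u).add (hℓ v)
  · refine tendsto_nhds_unique (hℓ (c • u)) ?_
    simpa using (hℓ u).const_mul c
  · refine ge_of_tendsto' (hℓ u) fun n => ?_
    rw [cesaro_apply, ContinuousMap.smul_apply, smul_eq_mul, ContinuousMap.sum_apply]
    refine mul_nonneg (by positivity) (Finset.sum_nonneg fun k _ => ?_)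
    exact mul_nonneg (by positivity) (hL.pow_nonneg hu k x₀)
  · have : ℓ f = f x₀ := tendsto_nhds_unique (hℓ f) (by
      simp only [cesaro_eigen hlam hfL]; exact tendsto_const_nhds)
    exact (hf x₀).trans_eq this.symm
  · have h0 : Tendsto (fun n => lam⁻¹ * cesaro L lam n (L u) x₀ - cesaro L lam n u x₀) U (𝓝 0) := by
      have h1 := ((continuous_eval_const x₀).tendsto (0 : C(X, ℝ))).comp
        (hL.tendsto_map_cesaro_sub hlam hf hfL u)
      refine (h1.mono_left hU).congr fun n => ?_
      simp [cesaro_map]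
    have h2 := tendsto_nhds_unique h0 (((hℓ (L u)).const_mul lam⁻¹).sub (hℓ u))
    show ℓ (L u) = lam * ℓ u
    field_simp at h2
    linarith

/-- An eigenmeasure of the dual operator, normalized to be a probability measure. -/
theorem exists_eigenprobability [Nonempty X] [T2Space X] [MeasurableSpace X] [BorelSpace X] :
    ∃ ρ : Measure X, IsProbabilityMeasure ρ ∧
      ∀ u : C(X, ℝ), ∫ x, L u x ∂ρ = lam * ∫ x, u x ∂ρ := by
  obtain ⟨ℓ, hpos, hℓf, hℓ⟩ := hL.exists_eigenfunctional hlam hf hfL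
  let Λ : CompactlySupportedContinuousMap X ℝ →ₚ[ℝ] ℝ := PositiveLinearMap.mk₀
    { toFun := fun u => ℓ u.toContinuousMap
      map_add' := fun u v => ℓ.map_add _ _
      map_smul' := fun c u => ℓ.map_smul c _ } fun u hu => hpos _ hu
  have hint : ∀ u : C(X, ℝ), ∫ x, u x ∂(RealRMK.rieszMeasure Λ) = ℓ u := fun u =>
    RealRMK.integral_rieszMeasure Λ (CompactlySupportedContinuousMap.continuousMapEquiv u)
  set m := RealRMK.rieszMeasure Λ with hm
  have hfin : IsFiniteMeasure m := ⟨isCompact_univ.measure_lt_top⟩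
  have hne : m ≠ 0 := by
    intro h
    have := hint f
    rw [h] at this
    simp at this
    linarith
  have : NeZero m := ⟨hne⟩
  refine ⟨(m Set.univ)⁻¹ • m, inferInstance, fun u => ?_⟩
  simp only [integral_smul_measure, hint, hℓ, smul_eq_mul]
  ring

omit hlam hf hfL in
/-- Eigenmeasures of the dual operator have full support. -/
lemma integral_pos_of_eigenmeasure [MeasurableSpace X] [BorelSpace X] {ρ : Measure X}
    [IsProbabilityMeasure ρ]
    (hρ : ∀ u : C(X, ℝ), ∫ x, L u x ∂ρ = lam * ∫ x, u x ∂ρ) {u : C(X, ℝ)} (h0 : ∀ x, 0 ≤ u x)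
    (hu : u ≠ 0) : 0 < ∫ x, u x ∂ρ := by
  refine lt_of_le_of_ne (integral_nonneg h0) fun h => ?_
  have hint : ∀ v : C(X, ℝ), Integrable (fun x => v x) ρ := fun v =>
    v.continuous.integrable_of_hasCompactSupport (HasCompactSupport.of_compactSpace _)
  have hpow : ∀ k : ℕ, ∫ x, (L ^ k) u x ∂ρ = 0 := fun k => by
    induction k with
    | zero => simpa using h.symm
    | succ k ih => rw [pow_succ_apply_comm, hρ, ih, mul_zero]
  have hae : ∀ᵐ x ∂ρ, ∀ k : ℕ, (L ^ k) u x = 0 := ae_all_iff.2 fun k =>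
    (integral_eq_zero_iff_of_nonneg (hL.pow_nonneg h0 k) (hint _)).1 (hpow k)
  obtain ⟨x, hx⟩ := hae.exists
  obtain ⟨n, hn⟩ := hL.exists_pos u h0 hu x
  exact hn.ne' (hx n)

end IsIrreducible

end CesaroAverages

/-! ### The subshift and its distance -/

section Subshift

variable {M : Type*} {A : M → M → ℝ} {I : Set ℝ}

@[simp] lemma cons_zero (a : M) (x : Adm A I) (h : A a (x.1 0) ∈ I) : (cons a x h).1 0 = a := rfl

@[simp] lemma cons_succ (a : M) (x : Adm A I) (h : A a (x.1 0) ∈ I) (n : ℕ) :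
    (cons a x h).1 (n + 1) = x.1 n := rfl

@[simp] lemma shift_apply (x : Adm A I) (n : ℕ) : (shift x).1 n = x.1 (n + 1) := rfl

lemma cons_shift (x : Adm A I) : cons (x.1 0) (shift x) (x.2 0) = x := by
  refine Subtype.ext (funext fun n => ?_)
  cases n <;> rfl

lemma shift_iterate_apply (x : Adm A I) (n k : ℕ) : (shift^[n] x).1 k = x.1 (k + n) := by
  induction n generalizing x with
  | zero => rfl
  | succ n ih => rw [Function.iterate_succ_apply, ih, shift_apply, add_assoc]

@[fun_prop]
lemma continuous_shift [TopologicalSpace M] : Continuous (shift : Adm A I → Adm A I) :=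
  continuous_induced_rng.2
    (continuous_pi fun n => (continuous_apply (n + 1)).comp continuous_subtype_val)

section Distance

variable [MetricSpace M] [CompactSpace M]

lemma dist_le_diam_univ (a b : M) : dist a b ≤ Metric.diam (Set.univ : Set M) :=
  Metric.dist_le_diam_of_mem isCompact_univ.isBounded (Set.mem_univ a) (Set.mem_univ b)

lemma seqDist_term_le (x y : Adm A I) (n : ℕ) :
    (1 / 2 : ℝ) ^ (n + 1) * dist (x.1 n) (y.1 n)
      ≤ (1 / 2 : ℝ) ^ (n + 1) * Metric.diam (Set.univ : Set M) :=
  mul_le_mul_of_nonneg_left (dist_le_diam_univ _ _) (by positivity)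

omit [CompactSpace M] in
lemma summable_seqDist_bound :
    Summable fun n : ℕ => (1 / 2 : ℝ) ^ (n + 1) * Metric.diam (Set.univ : Set M) :=
  ((summable_nat_add_iff 1).2 summable_geometric_two).mul_right _

lemma summable_seqDist (x y : Adm A I) :
    Summable fun n : ℕ => (1 / 2 : ℝ) ^ (n + 1) * dist (x.1 n) (y.1 n) :=
  Summable.of_nonneg_of_le (fun n => by positivity) (seqDist_term_le x y) summable_seqDist_bound

omit [CompactSpace M] in
lemma seqDist_nonneg (x y : Adm A I) : 0 ≤ seqDist x y := tsum_nonneg fun n => by positivity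

omit [CompactSpace M] in
lemma seqDist_self (x : Adm A I) : seqDist x x = 0 := by simp [seqDist]

omit [CompactSpace M] in
lemma seqDist_comm (x y : Adm A I) : seqDist x y = seqDist y x := by simp [seqDist, dist_comm]

lemma dist_le_seqDist (x y : Adm A I) (n : ℕ) :
    dist (x.1 n) (y.1 n) ≤ 2 ^ (n + 1) * seqDist x y := by
  have h := (summable_seqDist x y).le_tsum n fun k _ => by positivity
  calc dist (x.1 n) (y.1 n)
      = 2 ^ (n + 1) * ((1 / 2 : ℝ) ^ (n + 1) * dist (x.1 n) (y.1 n)) := by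
        rw [← mul_assoc, ← mul_pow]; norm_num
    _ ≤ _ := mul_le_mul_of_nonneg_left h (by positivity)

lemma eq_of_seqDist_eq_zero {x y : Adm A I} (h : seqDist x y = 0) : x = y := by
  refine Subtype.ext (funext fun n => dist_le_zero.1 ?_)
  simpa [h] using dist_le_seqDist x y n

lemma continuous_seqDist : Continuous fun p : Adm A I × Adm A I => seqDist p.1 p.2 := by
  refine continuous_tsum (fun n => ?_) (summable_seqDist_bound (M := M)) fun n p => ?_
  · have h1 : Continuous fun p : Adm A I × Adm A I => p.1.1 n :=
      (continuous_apply n).comp (continuous_subtype_val.comp continuous_fst)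
    have h2 : Continuous fun p : Adm A I × Adm A I => p.2.1 n :=
      (continuous_apply n).comp (continuous_subtype_val.comp continuous_snd)
    exact continuous_const.mul (h1.dist h2)
  · rw [Real.norm_of_nonneg (by positivity)]
    exact seqDist_term_le _ _ _

lemma seqDist_cons_cons (a b : M) (x y : Adm A I) (h : A a (x.1 0) ∈ I) (h' : A b (y.1 0) ∈ I) :
    seqDist (cons a x h) (cons b y h') = (dist a b + seqDist x y) / 2 := by
  unfold seqDist
  rw [(summable_seqDist (cons a x h) (cons b y h')).tsum_eq_zero_add]
  simp only [cons_zero, cons_succ, pow_succ _ (_ + 1), mul_right_comm _ (1 / 2 : ℝ), tsum_mul_right]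
  ring

lemma tendsto_seqDist (x : Adm A I) : Tendsto (fun y => seqDist y x) (𝓝 x) (𝓝[≥] 0) := by
  refine tendsto_nhdsWithin_iff.2 ⟨?_, Eventually.of_forall fun y => seqDist_nonneg _ _⟩
  have h : Continuous fun y : Adm A I => seqDist y x :=
    continuous_seqDist.comp (continuous_id.prodMk continuous_const)
  simpa [seqDist_self] using h.tendsto x

end Distance

section Holder

variable [MetricSpace M]

lemma IsHolder.exists_nonneg {X : Type*} {d : X → X → ℝ} {α : ℝ} {g : X → ℝ}
    (hd : ∀ x y, 0 ≤ d x y) (h : IsHolder d α g) :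
    ∃ C : ℝ, 0 ≤ C ∧ ∀ x y, |g x - g y| ≤ C * d x y ^ α := by
  obtain ⟨C, hC⟩ := h
  exact ⟨|C|, abs_nonneg C, fun x y => (hC x y).trans
    (mul_le_mul_of_nonneg_right (le_abs_self C) (Real.rpow_nonneg (hd x y) α))⟩

lemma continuous_of_tendsto_zero {X : Type*} [TopologicalSpace X] {d : X → X → ℝ} {α C : ℝ}
    (hα : 0 < α) {g : X → ℝ} (hd : ∀ x, Tendsto (fun y => d y x) (𝓝 x) (𝓝 0))
    (hC : ∀ x y, |g x - g y| ≤ C * d x y ^ α) : Continuous g := by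
  refine continuous_iff_continuousAt.2 fun x => ?_
  rw [ContinuousAt, tendsto_iff_norm_sub_tendsto_zero]
  have h : Tendsto (fun y => C * d y x ^ α) (𝓝 x) (𝓝 0) := by
    simpa [Real.zero_rpow hα.ne'] using
      (((Real.continuous_rpow_const hα.le).tendsto 0).comp (hd x)).const_mul C
  exact squeeze_zero (fun y => norm_nonneg _) (fun y => by simpa using hC y x) h

lemma IsHolder.continuous [CompactSpace M] {α : ℝ} (hα : 0 < α) {g : Adm A I → ℝ}
    (h : IsHolder seqDist α g) : Continuous g := by
  obtain ⟨C, hC⟩ := h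
  exact continuous_of_tendsto_zero hα
    (fun x => (tendsto_seqDist x).mono_right nhdsWithin_le_nhds) hC

lemma IsHolder.continuous_hat [CompactSpace M] {α : ℝ} (hα : 0 < α) {g : Hat A I → ℝ}
    (h : IsHolder hatDist α g) : Continuous g := by
  obtain ⟨C, hC⟩ := h
  refine continuous_of_tendsto_zero hα (fun p => ?_) hC
  have h1 : Tendsto (fun q : Hat A I => seqDist q.1.1 p.1.1) (𝓝 p) (𝓝 0) :=
    ((tendsto_seqDist p.1.1).mono_right nhdsWithin_le_nhds).comp
      ((continuous_fst.comp continuous_subtype_val).tendsto p)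
  have h2 : Tendsto (fun q : Hat A I => seqDist q.1.2 p.1.2) (𝓝 p) (𝓝 0) :=
    ((tendsto_seqDist p.1.2).mono_right nhdsWithin_le_nhds).comp
      ((continuous_snd.comp continuous_subtype_val).tendsto p)
  simpa [hatDist] using h1.add h2

end Holder

section LocallyProduct

/-- The consequences of the hypotheses on the admissibility relation on which the theory of the
Ruelle operator rests: the relation is clopen with locally constant sections, every admissible
sequence has a preimage under the shift, and the iterated preimages of every point are dense. -/
structure IsIrreducibleSubshift [TopologicalSpace M] (A : M → M → ℝ) (I : Set ℝ) : Prop where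
  isClopen : IsClopen {p : M × M | A p.1 p.2 ∈ I}
  locallyConstant : IsLocallyConstant (secSet A I)
  nonempty : Nonempty (Adm A I)
  exists_preimage : ∀ x : Adm A I, ∃ a, A a (x.1 0) ∈ I
  dense_preimages : ∀ U : Set (Adm A I), IsOpen U → U.Nonempty → ∀ z,
    ∃ n : ℕ, ∃ v ∈ U, shift^[n] v = z

lemma isClopen_of_isLocallyConstant [TopologicalSpace M] (hA : Continuous (Function.uncurry A))
    (hI : IsClosed I) (hs : IsLocallyConstant (secSet A I))
    (hs' : IsLocallyConstant (secSet (transpose A) I)) :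
    IsClopen {p : M × M | A p.1 p.2 ∈ I} := by
  refine ⟨hI.preimage hA, isOpen_iff_mem_nhds.2 fun ⟨a₀, b₀⟩ h => ?_⟩
  have h1 : ∀ᶠ p : M × M in 𝓝 (a₀, b₀), secSet A I p.2 = secSet A I b₀ :=
    (continuous_snd.tendsto (a₀, b₀)).eventually
      ((hs.isOpen_fiber _).mem_nhds (rfl : b₀ ∈ {b | secSet A I b = secSet A I b₀}))
  have h2 : ∀ᶠ p : M × M in 𝓝 (a₀, b₀), secSet (transpose A) I p.1 = secSet (transpose A) I a₀ :=
    (continuous_fst.tendsto (a₀, b₀)).eventually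
      ((hs'.isOpen_fiber _).mem_nhds
        (rfl : a₀ ∈ {a | secSet (transpose A) I a = secSet (transpose A) I a₀}))
  filter_upwards [h1, h2] with p hp1 hp2
  have h3 : b₀ ∈ secSet (transpose A) I p.1 := by rw [hp2]; exact h
  have h4 : p.1 ∈ secSet A I p.2 := by rw [hp1]; exact h3
  exact h4

lemma exists_pos_forall_dist_lt_secSet_eq [MetricSpace M] [CompactSpace M]
    (hs : IsLocallyConstant (secSet A I)) :
    ∃ δ : ℝ, 0 < δ ∧ ∀ a b : M, dist a b < δ → secSet A I a = secSet A I b := by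
  obtain ⟨δ, hδ, h⟩ := lebesgue_number_lemma_of_metric (s := (Set.univ : Set M)) isCompact_univ
    (c := fun b => {b' | secSet A I b' = secSet A I b}) (fun b => hs.isOpen_fiber _)
    (fun b _ => Set.mem_iUnion.2 ⟨b, rfl⟩)
  refine ⟨δ, hδ, fun x y hxy => ?_⟩
  obtain ⟨b, hb⟩ := h x (Set.mem_univ _)
  have e1 : secSet A I x = secSet A I b := hb (Metric.mem_ball_self hδ)
  have e2 : secSet A I y = secSet A I b := hb (by rwa [Metric.mem_ball, dist_comm])
  rw [e1, e2]

lemma exists_pos_forall_secSet_eq [MetricSpace M] [CompactSpace M]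
    (hs : IsLocallyConstant (secSet A I)) :
    ∃ ε : ℝ, 0 < ε ∧ ∀ x y : Adm A I, seqDist x y < ε →
      secSet A I (x.1 0) = secSet A I (y.1 0) := by
  obtain ⟨δ, hδ, h⟩ := exists_pos_forall_dist_lt_secSet_eq hs
  refine ⟨δ / 2, by positivity, fun x y hxy => h _ _ ?_⟩
  have := dist_le_seqDist x y 0
  norm_num at this
  linarith

lemma compactSpace_adm [TopologicalSpace M] [CompactSpace M]
    (h : IsClopen {p : M × M | A p.1 p.2 ∈ I}) : CompactSpace (Adm A I) := by
  refine isCompact_iff_compactSpace.1 (IsClosed.isCompact ?_ :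
    IsCompact {x : ℕ → M | ∀ n, A (x n) (x (n + 1)) ∈ I})
  simp only [Set.ofPred_forall]
  refine isClosed_iInter fun n => ?_
  have hc : Continuous fun x : ℕ → M => (x n, x (n + 1)) :=
    (continuous_apply n).prodMk (continuous_apply (n + 1))
  exact h.1.preimage hc

/-- Two admissible sequences can be joined after `n` steps. -/
lemma exists_splice (p z : Adm A I) (n : ℕ) (h : A (p.1 n) (z.1 0) ∈ I) :
    ∃ w : Adm A I, (∀ i, i ≤ n → w.1 i = p.1 i) ∧ shift^[n + 1] w = z := by
  induction n generalizing p with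
  | zero => exact ⟨cons (p.1 0) z h, fun i hi => by obtain rfl := Nat.le_zero.1 hi; rfl, rfl⟩
  | succ n ih =>
    obtain ⟨w, hw, hz⟩ := ih (shift p) h
    refine ⟨cons (p.1 0) w (by rw [hw 0 (Nat.zero_le n)]; exact p.2 0), fun i hi => ?_, hz⟩
    cases i with
    | zero => rfl
    | succ i => exact hw i (by omega)

/-- An open set that contains `x` contains every point with the same first coordinates, if there
are enough of these. -/
lemma eventually_mem_of_agree [TopologicalSpace M] {U : Set (Adm A I)} (hU : IsOpen U)
    {x : Adm A I} (hx : x ∈ U) (w : ℕ → Adm A I) (hw : ∀ k i, i < k → (w k).1 i = x.1 i) :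
    ∃ k, w k ∈ U := by
  have : Tendsto w atTop (𝓝 x) := by
    refine tendsto_subtype_rng.2 (tendsto_pi_nhds.2 fun i => ?_)
    refine tendsto_const_nhds.congr' ?_
    filter_upwards [eventually_gt_atTop i] with k hk using (hw k i hk).symm
  exact (this.eventually (hU.mem_nhds hx)).exists

lemma continuous_coord [TopologicalSpace M] (n : ℕ) : Continuous fun x : Adm A I => x.1 n :=
  (continuous_apply n).comp continuous_subtype_val

lemma isOpen_secSet_coord [TopologicalSpace M] (h : IsClopen {p : M × M | A p.1 p.2 ∈ I}) (a : M) :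
    IsOpen {x : Adm A I | A a (x.1 0) ∈ I} :=
  h.2.preimage (continuous_const.prodMk (continuous_coord 0))

/-- A topologically transitive subshift is irreducible. -/
lemma IsTransitive.isIrreducibleSubshift [TopologicalSpace M] (hne : Nonempty (Adm A I))
    (hR : IsClopen {p : M × M | A p.1 p.2 ∈ I}) (hs : IsLocallyConstant (secSet A I))
    (h : IsTransitive A I) : IsIrreducibleSubshift A I := by
  have hopen : ∀ z : Adm A I, IsOpen {w : Adm A I | secSet A I (w.1 0) = secSet A I (z.1 0)} :=
    fun z => (hs.isOpen_fiber _).preimage (continuous_coord 0)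
  refine ⟨hR, hs, hne, fun x => ?_, fun U hU ⟨x, hx⟩ z => ?_⟩
  · obtain ⟨n, hn, v, hv, -⟩ := h _ Set.univ (hopen x) isOpen_univ ⟨x, rfl⟩ ⟨x, trivial⟩
    obtain ⟨m, rfl⟩ := Nat.exists_eq_add_of_le' hn
    refine ⟨v.1 m, ?_⟩
    have hv' : secSet A I ((shift^[m + 1] v).1 0) = secSet A I (x.1 0) := hv
    have : v.1 m ∈ secSet A I ((shift^[m + 1] v).1 0) := by
      rw [shift_iterate_apply, zero_add]; exact v.2 m
    rwa [hv'] at this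
  · -- the first coordinates of `x`, then a path to the neighbourhood of `z`, then `z` itself
    have key : ∀ k : ℕ, ∃ w : Adm A I, (∀ i, i ≤ k → w.1 i = x.1 i) ∧ ∃ n, shift^[n] w = z := by
      intro k
      obtain ⟨n, hn, v, hv, hv0⟩ := h _ _ (hopen z) (isOpen_secSet_coord hR (x.1 k)) ⟨z, rfl⟩
        ⟨shift^[k + 1] x, by
          show A _ _ ∈ I
          rw [shift_iterate_apply, zero_add]; exact x.2 k⟩
      obtain ⟨m, rfl⟩ := Nat.exists_eq_add_of_le' hn
      have hv' : secSet A I ((shift^[m + 1] v).1 0) = secSet A I (z.1 0) := hv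
      have hz : v.1 m ∈ secSet A I ((shift^[m + 1] v).1 0) := by
        rw [shift_iterate_apply, zero_add]; exact v.2 m
      rw [hv'] at hz
      obtain ⟨w, hw, hwz⟩ := exists_splice v z m hz
      obtain ⟨w', hw', hwz'⟩ := exists_splice x w k (by rw [hw 0 (Nat.zero_le m)]; exact hv0)
      refine ⟨w', hw', (m + 1) + (k + 1), ?_⟩
      rw [Function.iterate_add_apply, hwz', hwz]
    choose w hw n hn using key
    obtain ⟨k, hk⟩ := eventually_mem_of_agree hU hx w fun k i hi => hw k i hi.le
    exact ⟨n k, w k, hk, hn k⟩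

lemma bishift_iterate_snd (p : Hat A I) (n : ℕ) :
    ((bishift A I)^[n] p).1.2 = shift^[n] p.1.2 := by
  induction n with
  | zero => rfl
  | succ n ih => rw [Function.iterate_succ_apply', Function.iterate_succ_apply', ← ih]; rfl

lemma shift_iterate_bishift_iterate_fst (p : Hat A I) (n : ℕ) :
    shift^[n] ((bishift A I)^[n] p).1.1 = p.1.1 := by
  induction n with
  | zero => rfl
  | succ n ih => rw [Function.iterate_succ_apply, Function.iterate_succ_apply', ← ih]; rfl

lemma bishift_iterate_fst_congr (p q : Hat A I) (h : p.1.2 = q.1.2) (n : ℕ) :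
    ∀ i, i < n → ((bishift A I)^[n] p).1.1.1 i = ((bishift A I)^[n] q).1.1.1 i := by
  induction n with
  | zero => intro i hi; omega
  | succ n ih =>
    intro i hi
    rw [Function.iterate_succ_apply', Function.iterate_succ_apply']
    cases i with
    | zero =>
      have := bishift_iterate_snd p n
      rw [h, ← bishift_iterate_snd q n] at this
      exact congrArg (fun x : Adm A I => x.1 0) this
    | succ i => exact ih i (by omega)

/-- The transposed subshift is irreducible: a path in `B` from `z` to the reversal of the first
coordinates of `y` is, read backwards, a path in `B^*` from these coordinates to `z`. -/
lemma IsIrreducibleSubshift.transpose [TopologicalSpace M] (h : IsIrreducibleSubshift A I)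
    (hs' : IsLocallyConstant (secSet (transpose A) I))
    (hext : ∀ y : Adm (transpose A) I, ∃ x : Adm A I, A (y.1 0) (x.1 0) ∈ I) :
    IsIrreducibleSubshift (transpose A) I := by
  refine ⟨h.isClopen.preimage continuous_swap, hs', ?_, fun y => ?_, fun U hU ⟨y, hy⟩ z => ?_⟩
  · obtain ⟨x₀⟩ := h.nonempty
    choose g hg using h.exists_preimage
    let u : ℕ → Adm A I := fun n => Nat.rec x₀ (fun _ x => cons (g x) x (hg x)) n
    exact ⟨⟨fun n => (u n).1 0, fun n => hg (u n)⟩⟩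
  · obtain ⟨x, hx⟩ := hext y
    exact ⟨x.1 0, hx⟩
  · obtain ⟨x, hx⟩ := hext y
    obtain ⟨x', hx'⟩ := hext z
    have key : ∀ k : ℕ, ∃ w : Adm (InvolutionKernel.transpose A) I,
        (∀ i, i < k → w.1 i = y.1 i) ∧ ∃ n, shift^[n] w = z := by
      intro k
      set q : Hat A I := (bishift A I).symm^[k] ⟨(y, x), hx⟩ with hq
      have hq' : (bishift A I)^[k] q = ⟨(y, x), hx⟩ :=
        (Function.LeftInverse.iterate (bishift A I).right_inv k) _
      obtain ⟨n, p, hp, hpq⟩ := h.dense_preimages _ (isOpen_secSet_coord h.isClopen (z.1 0))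
        ⟨x', hx'⟩ q.1.2
      let zp : Hat A I := ⟨(z, p), hp⟩
      refine ⟨((bishift A I)^[k] ((bishift A I)^[n] zp)).1.1, fun i hi => ?_, n + k, ?_⟩
      · rw [bishift_iterate_fst_congr _ q ((bishift_iterate_snd zp n).trans hpq) k i hi, hq']
      · rw [Function.iterate_add_apply, shift_iterate_bishift_iterate_fst,
          shift_iterate_bishift_iterate_fst]
    choose w hw n hn using key
    obtain ⟨k, hk⟩ := eventually_mem_of_agree hU hy w hw
    exact ⟨n k, w k, hk, hn k⟩

end LocallyProduct

end Subshift

/-! ### The Ruelle operator on continuous functions -/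

section Operator

lemma continuous_dite_of_isClopen {Y : Type*} [TopologicalSpace Y] {P : Y → Prop}
    [DecidablePred P] (hP : IsClopen {y | P y}) {F : ∀ y, P y → ℝ}
    (hF : Continuous fun y : {y // P y} => F y.1 y.2) :
    Continuous fun y => if h : P y then F y h else 0 := by
  refine continuous_iff_continuousAt.2 fun y => ?_
  by_cases h : P y
  · have he : Topology.IsOpenEmbedding (Subtype.val : {y // P y} → Y) :=
      IsOpen.isOpenEmbedding_subtypeVal hP.2
    refine (he.continuousAt_iff (x := ⟨y, h⟩)).1 ?_
    refine hF.continuousAt.congr (Eventually.of_forall fun z => ?_)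
    simp [z.2]
  · have : ∀ᶠ z in 𝓝 y, (0 : ℝ) = if h : P z then F z h else 0 := by
      filter_upwards [hP.1.isOpen_compl.mem_nhds h] with z hz
      have hz' : ¬ P z := hz
      rw [dif_neg hz']
    exact (continuousAt_const.congr this)

variable {M : Type*} {A : M → M → ℝ} {I : Set ℝ}

open Classical in
/-- The function `(a, x) ↦ g(ax)`, extended by `0` to the pairs `(a, x)` for which `ax` is not
admissible. It turns integrals over the variable domains `s(x_1)` into integrals over `M`. -/
noncomputable def extCons (g : Adm A I → ℝ) (a : M) (x : Adm A I) : ℝ :=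
  if h : A a (x.1 0) ∈ I then g (cons a x h) else 0

lemma extCons_of_mem (g : Adm A I → ℝ) {a : M} {x : Adm A I} (h : A a (x.1 0) ∈ I) :
    extCons g a x = g (cons a x h) := dif_pos h

lemma extCons_of_notMem (g : Adm A I → ℝ) {a : M} {x : Adm A I} (h : A a (x.1 0) ∉ I) :
    extCons g a x = 0 := dif_neg h

lemma extCons_nonneg {g : Adm A I → ℝ} (h : ∀ x, 0 ≤ g x) (a : M) (x : Adm A I) :
    0 ≤ extCons g a x := by
  by_cases ha : A a (x.1 0) ∈ I
  · rw [extCons_of_mem _ ha]; exact h _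
  · rw [extCons_of_notMem _ ha]

lemma continuous_extCons [TopologicalSpace M] (hR : IsClopen {p : M × M | A p.1 p.2 ∈ I})
    {g : Adm A I → ℝ} (hg : Continuous g) :
    Continuous fun p : M × Adm A I => extCons g p.1 p.2 := by
  classical
  have hc : Continuous fun p : M × Adm A I => (p.1, p.2.1 0) :=
    continuous_fst.prodMk ((continuous_coord 0).comp continuous_snd)
  have key : Continuous fun p : {p : M × Adm A I // A p.1 (p.2.1 0) ∈ I} =>
      cons p.1.1 p.1.2 p.2 := by
    refine continuous_induced_rng.2 (continuous_pi fun n => ?_)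
    cases n with
    | zero => exact continuous_fst.comp continuous_subtype_val
    | succ n =>
      exact (continuous_coord n).comp (continuous_snd.comp continuous_subtype_val)
  have := continuous_dite_of_isClopen (P := fun p : M × Adm A I => A p.1 (p.2.1 0) ∈ I)
    (hR.preimage hc) (F := fun p h => g (cons p.1 p.2 h)) (hg.comp key)
  refine this.congr fun p => ?_
  unfold extCons
  congr

lemma isClosed_secSet [TopologicalSpace M] (hR : IsClopen {p : M × M | A p.1 p.2 ∈ I}) (b : M) :
    IsClosed (secSet A I b) := by
  have hc : Continuous fun a : M => (a, b) := continuous_id.prodMk continuous_const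
  exact hR.1.preimage hc

variable [MetricSpace M] [MeasurableSpace M] [BorelSpace M] (ν : Measure M)

lemma ruelle_eq_integral (hR : IsClopen {p : M × M | A p.1 p.2 ∈ I}) (φ ψ : Adm A I → ℝ)
    (x : Adm A I) :
    ruelle ν φ ψ x = ∫ a, extCons (fun z => Real.exp (φ z) * ψ z) a x ∂ν := by
  have h1 : ruelle ν φ ψ x = ∫ a : secSet A I (x.1 0),
      extCons (fun z => Real.exp (φ z) * ψ z) a.1 x ∂(ν.comap Subtype.val) :=
    integral_congr_ae (Eventually.of_forall fun a =>
      (extCons_of_mem (fun z => Real.exp (φ z) * ψ z) a.2).symm)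
  rw [h1, integral_subtype_comap (isClosed_secSet hR _).measurableSet
    (fun a => extCons (fun z => Real.exp (φ z) * ψ z) a x)]
  exact setIntegral_eq_integral_of_forall_compl_eq_zero fun a ha => extCons_of_notMem _ ha

variable [CompactSpace M] [IsProbabilityMeasure ν]

lemma integrable_of_continuous {Y : Type*} [TopologicalSpace Y] [CompactSpace Y]
    [MeasurableSpace Y] [OpensMeasurableSpace Y] [SecondCountableTopology Y] {m : Measure Y}
    [IsFiniteMeasure m] {g : Y → ℝ} (hg : Continuous g) : Integrable g m :=
  hg.integrable_of_hasCompactSupport (HasCompactSupport.of_compactSpace _)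

omit [MeasurableSpace M] [BorelSpace M] [CompactSpace M] in
lemma continuous_extCons_left (hR : IsClopen {p : M × M | A p.1 p.2 ∈ I}) {g : Adm A I → ℝ}
    (hg : Continuous g) (x : Adm A I) : Continuous fun a => extCons g a x :=
  (continuous_extCons hR hg).comp (continuous_id.prodMk continuous_const)

lemma integrable_extCons (hR : IsClopen {p : M × M | A p.1 p.2 ∈ I}) {g : Adm A I → ℝ}
    (hg : Continuous g) (x : Adm A I) : Integrable (fun a => extCons g a x) ν :=
  integrable_of_continuous (continuous_extCons_left hR hg x)

lemma continuous_integral_left {Y Z : Type*} [TopologicalSpace Y] [CompactSpace Y]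
    [MeasurableSpace Y] [OpensMeasurableSpace Y] [SecondCountableTopology Y] [TopologicalSpace Z]
    [CompactSpace Z] [FirstCountableTopology Z] [T2Space Z] (m : Measure Y) [IsFiniteMeasure m]
    {g : Y → Z → ℝ} (hg : Continuous fun p : Y × Z => g p.1 p.2) :
    Continuous fun z => ∫ y, g y z ∂m := by
  have h : Continuous (Function.uncurry fun z y => g y z) := hg.comp continuous_swap
  simpa using continuous_parametric_integral_of_continuous (μ := m) h isCompact_univ

lemma continuous_ruelle [CompactSpace (Adm A I)] (hR : IsClopen {p : M × M | A p.1 p.2 ∈ I})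
    {φ ψ : Adm A I → ℝ} (hφ : Continuous φ) (hψ : Continuous ψ) : Continuous (ruelle ν φ ψ) := by
  have h : ruelle ν φ ψ = fun x => ∫ a, extCons (fun z => Real.exp (φ z) * ψ z) a x ∂ν :=
    funext fun x => ruelle_eq_integral ν hR φ ψ x
  rw [h]
  exact continuous_integral_left ν (continuous_extCons hR (by fun_prop))

omit [CompactSpace M] in
lemma abs_ruelle_le [CompactSpace (Adm A I)] (hR : IsClopen {p : M × M | A p.1 p.2 ∈ I})
    (φ ψ : C(Adm A I, ℝ)) (x : Adm A I) :
    |ruelle ν φ ψ x| ≤ Real.exp ‖φ‖ * ‖ψ‖ := by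
  rw [ruelle_eq_integral ν hR, ← Real.norm_eq_abs]
  have h : ∀ a, ‖extCons (fun z => Real.exp (φ z) * ψ z) a x‖ ≤ Real.exp ‖φ‖ * ‖ψ‖ := fun a => by
    by_cases ha : A a (x.1 0) ∈ I
    · rw [extCons_of_mem _ ha, norm_mul, Real.norm_of_nonneg (Real.exp_pos _).le]
      exact mul_le_mul (Real.exp_le_exp.2 ((le_abs_self _).trans (φ.norm_coe_le_norm _)))
        (ψ.norm_coe_le_norm _) (norm_nonneg _) (Real.exp_pos _).le
    · rw [extCons_of_notMem _ ha, norm_zero]; positivity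
  simpa using norm_integral_le_of_norm_le_const (μ := ν) (Eventually.of_forall h)

/-- The Ruelle operator as a bounded operator on `C(B)`. -/
noncomputable def transfer [CompactSpace (Adm A I)] (hR : IsClopen {p : M × M | A p.1 p.2 ∈ I})
    (φ : C(Adm A I, ℝ)) : C(Adm A I, ℝ) →L[ℝ] C(Adm A I, ℝ) :=
  LinearMap.mkContinuous
    { toFun := fun ψ => ⟨ruelle ν φ ψ, continuous_ruelle ν hR φ.continuous ψ.continuous⟩
      map_add' := fun u v => by
        ext x
        simp only [ContinuousMap.coe_mk, ContinuousMap.add_apply, ruelle_eq_integral ν hR]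
        rw [← integral_add (integrable_extCons ν hR (by fun_prop) x)
          (integrable_extCons ν hR (by fun_prop) x)]
        refine integral_congr_ae (Eventually.of_forall fun a => ?_)
        by_cases ha : A a (x.1 0) ∈ I
        · simp only [extCons_of_mem _ ha, mul_add]
        · simp only [extCons_of_notMem _ ha, add_zero]
      map_smul' := fun c u => by
        ext x
        simp only [ContinuousMap.coe_mk, ContinuousMap.smul_apply, smul_eq_mul, RingHom.id_apply,
          ruelle_eq_integral ν hR]
        rw [← integral_const_mul]
        refine integral_congr_ae (Eventually.of_forall fun a => ?_)
        by_cases ha : A a (x.1 0) ∈ I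
        · simp only [extCons_of_mem _ ha, mul_left_comm]
        · simp only [extCons_of_notMem _ ha, mul_zero] }
    (Real.exp ‖φ‖) fun ψ => (ContinuousMap.norm_le _ (by positivity)).2 fun x =>
      abs_ruelle_le ν hR φ ψ x

@[simp] lemma transfer_apply [CompactSpace (Adm A I)]
    (hR : IsClopen {p : M × M | A p.1 p.2 ∈ I}) (φ ψ : C(Adm A I, ℝ)) (x : Adm A I) :
    transfer ν hR φ ψ x = ruelle ν φ ψ x := rfl

lemma isEigen_iff_transfer [CompactSpace (Adm A I)]
    (hR : IsClopen {p : M × M | A p.1 p.2 ∈ I}) (φ ψ : C(Adm A I, ℝ)) (κ : ℝ) :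
    IsEigen ν φ κ ψ ↔ transfer ν hR φ ψ = κ • ψ :=
  ⟨fun h => ContinuousMap.ext h, fun h x => DFunLike.congr_fun h x⟩

variable [ν.IsOpenPosMeasure]

lemma ruelle_pos [CompactSpace (Adm A I)] (hR : IsClopen {p : M × M | A p.1 p.2 ∈ I})
    (φ u : C(Adm A I, ℝ)) (h0 : ∀ x, 0 ≤ u x) {a : M} {x : Adm A I} (h : A a (x.1 0) ∈ I)
    (hu : 0 < u (cons a x h)) : 0 < ruelle ν φ u x := by
  rw [ruelle_eq_integral ν hR]
  have hc := continuous_extCons_left hR (g := fun z => Real.exp (φ z) * u z) (by fun_prop) x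
  refine hc.integral_pos_of_hasCompactSupport_nonneg_nonzero (HasCompactSupport.of_compactSpace _)
    (fun a => extCons_nonneg (fun z => mul_nonneg (Real.exp_pos _).le (h0 z)) a x) (x := a) ?_
  rw [extCons_of_mem _ h]
  exact (mul_pos (Real.exp_pos _) hu).ne'

lemma isIrreducible_transfer [CompactSpace (Adm A I)] (hB : IsIrreducibleSubshift A I)
    (φ : C(Adm A I, ℝ)) : IsIrreducible (transfer ν hB.isClopen φ) := by
  have hnn : ∀ u : C(Adm A I, ℝ), (∀ x, 0 ≤ u x) → ∀ x, 0 ≤ transfer ν hB.isClopen φ u x := by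
    intro u hu x
    rw [transfer_apply, ruelle_eq_integral ν hB.isClopen]
    exact integral_nonneg fun a =>
      extCons_nonneg (fun z => mul_nonneg (Real.exp_pos _).le (hu z)) a x
  refine ⟨hnn, fun u hu hne x => ?_, fun x => ?_⟩
  · obtain ⟨v₀, hv₀⟩ : ∃ v, u v ≠ 0 := by
      by_contra! h
      exact hne (ContinuousMap.ext h)
    obtain ⟨n, v, hv, rfl⟩ := hB.dense_preimages {v | 0 < u v}
      (isOpen_lt continuous_const u.continuous) ⟨v₀, lt_of_le_of_ne (hu v₀) hv₀.symm⟩ x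
    refine ⟨n, ?_⟩
    clear hne hv₀
    induction n generalizing u v with
    | zero => simpa using hv
    | succ n ih =>
      rw [pow_succ]
      refine ih (transfer ν hB.isClopen φ u) (hnn u hu) (shift v) ?_
      refine ruelle_pos ν hB.isClopen φ u hu (a := v.1 0) (v.2 0) ?_
      rwa [cons_shift]
  · obtain ⟨a, ha⟩ := hB.exists_preimage x
    exact ruelle_pos ν hB.isClopen φ 1 (fun _ => zero_le_one) ha zero_lt_one

end Operator

/-! ### An invariant cone of functions with controlled logarithm -/

section Cone

variable {M : Type*} [MetricSpace M] [CompactSpace M] {A : M → M → ℝ} {I : Set ℝ}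

/-- The cone of the non-negative functions `u` with `log u` of modulus of continuity `θ` at
distances less than `ε`, written without the logarithm so that `u` may vanish. -/
def logCone (A : M → M → ℝ) (I : Set ℝ) (θ : ℝ → ℝ) (ε : ℝ) : Set C(Adm A I, ℝ) :=
  {u | (∀ x, 0 ≤ u x) ∧ ∀ x y, seqDist x y < ε → u x ≤ Real.exp (θ (seqDist x y)) * u y}

omit [CompactSpace M] in
lemma abs_sub_le_of_log_modulus {θ : ℝ → ℝ} {ε R : ℝ} {g : Adm A I → ℝ}
    (h0 : ∀ x, 0 ≤ g x ∧ g x ≤ R)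
    (h : ∀ x y, seqDist x y < ε → g x ≤ Real.exp (θ (seqDist x y)) * g y) {x y : Adm A I}
    (hxy : seqDist x y < ε) : |g x - g y| ≤ |Real.exp (θ (seqDist x y)) - 1| * R := by
  have key : ∀ a b : Adm A I, seqDist a b = seqDist x y →
      g a - g b ≤ |Real.exp (θ (seqDist x y)) - 1| * R := fun a b hab => by
    have h1 := h a b (hab ▸ hxy)
    rw [hab] at h1
    calc g a - g b ≤ (Real.exp (θ (seqDist x y)) - 1) * g b := by linarith
      _ ≤ |Real.exp (θ (seqDist x y)) - 1| * g b :=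
        mul_le_mul_of_nonneg_right (le_abs_self _) (h0 b).1
      _ ≤ _ := mul_le_mul_of_nonneg_left (h0 b).2 (abs_nonneg _)
  refine abs_le'.2 ⟨key x y rfl, ?_⟩
  rw [neg_sub]
  exact key y x (seqDist_comm y x)

lemma isCompact_logCone_norm_le [CompactSpace (Adm A I)] {θ : ℝ → ℝ} {ε : ℝ} (hε : 0 < ε)
    (hθ : Tendsto θ (𝓝[≥] 0) (𝓝 0)) (R : ℝ) :
    IsCompact {u | u ∈ logCone A I θ ε ∧ ‖u‖ ≤ R} := by
  rcases lt_or_ge R 0 with hR | hR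
  · convert isCompact_empty
    ext u
    simp only [Set.mem_ofPred_eq, Set.mem_empty_iff_false, iff_false, not_and, not_le]
    exact fun _ => hR.trans_le (norm_nonneg u)
  set T : Set (Adm A I → ℝ) := {g | (∀ x, 0 ≤ g x ∧ g x ≤ R) ∧
    ∀ x y, seqDist x y < ε → g x ≤ Real.exp (θ (seqDist x y)) * g y} with hT
  have hb : ∀ x : Adm A I,
      Tendsto (fun y => |Real.exp (θ (seqDist y x)) - 1| * R) (𝓝 x) (𝓝 0) := fun x => by
    have h1 : Tendsto (fun y => θ (seqDist y x)) (𝓝 x) (𝓝 0) := hθ.comp (tendsto_seqDist x)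
    have h2 := (((Real.continuous_exp.tendsto 0).comp h1).sub_const 1).abs.mul_const R
    simpa using h2
  have hnear : ∀ x : Adm A I, ∀ᶠ y in 𝓝 x, seqDist y x < ε := fun x =>
    ((tendsto_seqDist x).mono_right nhdsWithin_le_nhds).eventually (gt_mem_nhds hε)
  have hcont : ∀ g ∈ T, Continuous g := fun g hg => by
    refine continuous_iff_continuousAt.2 fun x => ?_
    rw [ContinuousAt, tendsto_iff_norm_sub_tendsto_zero]
    refine squeeze_zero' (Eventually.of_forall fun y => norm_nonneg _) ?_ (hb x)
    filter_upwards [hnear x] with y hy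
    exact abs_sub_le_of_log_modulus hg.1 hg.2 hy
  have hsub : ∀ u : C(Adm A I, ℝ), u ∈ logCone A I θ ε ∧ ‖u‖ ≤ R → (u : Adm A I → ℝ) ∈ T :=
    fun u hu => ⟨fun x => ⟨hu.1.1 x, (le_abs_self _).trans ((u.norm_coe_le_norm x).trans hu.2)⟩,
      hu.1.2⟩
  have himg : ContinuousMap.toFun '' {u | u ∈ logCone A I θ ε ∧ ‖u‖ ≤ R} = T := by
    refine Set.Subset.antisymm ?_ fun g hg => ?_
    · rintro _ ⟨u, hu, rfl⟩
      exact hsub u hu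
    · refine ⟨⟨g, hcont g hg⟩, ⟨⟨fun x => (hg.1 x).1, hg.2⟩, ?_⟩, rfl⟩
      refine (ContinuousMap.norm_le _ hR).2 fun x => ?_
      show |g x| ≤ R
      rw [abs_of_nonneg (hg.1 x).1]
      exact (hg.1 x).2
  refine ArzelaAscoli.isCompact_of_equicontinuous _ ?_ ?_
  · rw [himg]
    have hbox := isCompact_univ_pi fun _ : Adm A I => isCompact_Icc (a := (0 : ℝ)) (b := R)
    refine hbox.of_isClosed_subset ?_ fun g hg x _ => hg.1 x
    have hc : IsClosed {g : Adm A I → ℝ | ∀ x, 0 ≤ g x ∧ g x ≤ R} := by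
      simp only [Set.ofPred_forall]
      exact isClosed_iInter fun x =>
        (isClosed_le continuous_const (continuous_apply x)).inter
          (isClosed_le (continuous_apply x) continuous_const)
    refine hc.inter (?_ : IsClosed {g : Adm A I → ℝ |
      ∀ x y, seqDist x y < ε → g x ≤ Real.exp (θ (seqDist x y)) * g y})
    simp only [Set.ofPred_forall]
    exact isClosed_iInter fun x => isClosed_iInter fun y => isClosed_iInter fun _ =>
      isClosed_le (continuous_apply x) (continuous_const.mul (continuous_apply y))
  · intro x
    refine Metric.equicontinuousAt_of_continuity_modulus _ (hb x) _ ?_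
    filter_upwards [hnear x] with y hy u
    rw [dist_comm, Real.dist_eq]
    exact abs_sub_le_of_log_modulus (hsub u.1 u.2).1 (hsub u.1 u.2).2 hy

variable [MeasurableSpace M] [BorelSpace M] (ν : Measure M) [IsProbabilityMeasure ν]

/-- The Ruelle operator preserves `logCone θ ε` as soon as `θ` absorbs the variation of `φ`,
because prepending a symbol halves distances. -/
lemma isCompactInvariantCone_logCone [CompactSpace (Adm A I)]
    (hR : IsClopen {p : M × M | A p.1 p.2 ∈ I}) (φ : C(Adm A I, ℝ)) {α C ε : ℝ}
    (hφ : ∀ x y, |φ x - φ y| ≤ C * seqDist x y ^ α) (hε : 0 < ε)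
    (hs : ∀ x y : Adm A I, seqDist x y < ε → secSet A I (x.1 0) = secSet A I (y.1 0))
    {θ : ℝ → ℝ} (hθ : Tendsto θ (𝓝[≥] 0) (𝓝 0))
    (hθC : ∀ t, 0 ≤ t → θ (t / 2) + C * (t / 2) ^ α ≤ θ t) :
    IsCompactInvariantCone (transfer ν hR φ) (logCone A I θ ε) where
  nonneg u hu := hu.1
  add_mem u hu v hv := ⟨fun x => add_nonneg (hu.1 x) (hv.1 x), fun x y h => by
    rw [ContinuousMap.add_apply, ContinuousMap.add_apply, mul_add]
    exact add_le_add (hu.2 x y h) (hv.2 x y h)⟩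
  smul_mem c hc u hu := ⟨fun x => mul_nonneg hc (hu.1 x), fun x y h => by
    have := mul_le_mul_of_nonneg_left (hu.2 x y h) hc
    rw [mul_left_comm] at this
    exact this⟩
  isCompact R := isCompact_logCone_norm_le hε hθ R
  map_mem u hu := by
    refine ⟨fun x => ?_, fun x y h => ?_⟩
    · rw [transfer_apply, ruelle_eq_integral ν hR]
      exact integral_nonneg fun a =>
        extCons_nonneg (fun z => mul_nonneg (Real.exp_pos _).le (hu.1 z)) a x
    · rw [transfer_apply, transfer_apply, ruelle_eq_integral ν hR, ruelle_eq_integral ν hR,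
        ← integral_const_mul]
      refine integral_mono (integrable_extCons ν hR (by fun_prop) x)
        ((integrable_extCons ν hR (by fun_prop) y).const_mul _) fun a => ?_
      have hiff : A a (x.1 0) ∈ I ↔ A a (y.1 0) ∈ I := Set.ext_iff.1 (hs x y h) a
      by_cases ha : A a (x.1 0) ∈ I
      · have ha' := hiff.1 ha
        simp only [extCons_of_mem _ ha, extCons_of_mem _ ha']
        have hd : seqDist (cons a x ha) (cons a y ha') = seqDist x y / 2 := by
          rw [seqDist_cons_cons, dist_self, zero_add]
        have h0 := seqDist_nonneg x y
        have h1 := hu.2 (cons a x ha) (cons a y ha') (by rw [hd]; linarith)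
        have h2 := (le_abs_self _).trans (hφ (cons a x ha) (cons a y ha'))
        rw [hd] at h1 h2
        have h3 := hθC (seqDist x y) h0
        calc Real.exp (φ (cons a x ha)) * u (cons a x ha)
            ≤ Real.exp (φ (cons a x ha)) *
              (Real.exp (θ (seqDist x y / 2)) * u (cons a y ha')) :=
              mul_le_mul_of_nonneg_left h1 (Real.exp_pos _).le
          _ = Real.exp (φ (cons a x ha) + θ (seqDist x y / 2)) * u (cons a y ha') := by
              rw [Real.exp_add, mul_assoc]
          _ ≤ Real.exp (θ (seqDist x y) + φ (cons a y ha')) * u (cons a y ha') :=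
              mul_le_mul_of_nonneg_right (Real.exp_le_exp.2 (by linarith)) (hu.1 _)
          _ = _ := by rw [Real.exp_add, mul_assoc]
      · have ha' := fun h' => ha (hiff.2 h')
        simp only [extCons_of_notMem _ ha, extCons_of_notMem _ ha', mul_zero, le_refl]

end Cone

section Moduli

/-- If `φ` has Hölder constant `C`, then the logarithm of the positive eigenfunction has local
Hölder constant `C * logHolderFactor α`, the solution `H` of `(H + C) 2^{-α} = H`. -/
noncomputable def logHolderFactor (α : ℝ) : ℝ := (1 / 2) ^ α / (1 - (1 / 2) ^ α)

lemma half_rpow_lt_one {α : ℝ} (hα : 0 < α) : (1 / 2 : ℝ) ^ α < 1 :=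
  Real.rpow_lt_one (by norm_num) (by norm_num) hα

lemma logHolderFactor_nonneg {α : ℝ} (hα : 0 < α) : 0 ≤ logHolderFactor α :=
  div_nonneg (by positivity) (by linarith [half_rpow_lt_one hα])

lemma logHolderFactor_absorbs {α : ℝ} (hα : 0 < α) (C : ℝ) {t : ℝ} (ht : 0 ≤ t) :
    C * logHolderFactor α * (t / 2) ^ α + C * (t / 2) ^ α = C * logHolderFactor α * t ^ α := by
  have h1 : (t / 2) ^ α = t ^ α * (1 / 2) ^ α := by
    rw [div_eq_mul_one_div, Real.mul_rpow ht (by norm_num)]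
  have h2 : 1 - (1 / 2 : ℝ) ^ α ≠ 0 := by linarith [half_rpow_lt_one hα]
  rw [h1, logHolderFactor]
  field_simp
  ring

lemma tendsto_rpow_modulus {α : ℝ} (hα : 0 < α) (H : ℝ) :
    Tendsto (fun t : ℝ => H * t ^ α) (𝓝[≥] 0) (𝓝 0) := by
  have := ((Real.continuous_rpow_const hα.le).tendsto (0 : ℝ)).const_mul H
  rw [Real.zero_rpow hα.ne', mul_zero] at this
  exact this.mono_left nhdsWithin_le_nhds

variable {M : Type*} [MetricSpace M] [CompactSpace M] {A : M → M → ℝ} {I : Set ℝ}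
  [CompactSpace (Adm A I)]

omit [CompactSpace M] in
lemma isHolder_of_mem_logCone {α H ε : ℝ} (hα : 0 < α) (hH : 0 ≤ H) (hε : 0 < ε)
    {f : C(Adm A I, ℝ)} (hf : f ∈ logCone A I (fun t => H * t ^ α) ε) :
    IsHolder seqDist α f := by
  refine ⟨H * Real.exp (H * ε ^ α) * ‖f‖ + 2 * ‖f‖ / ε ^ α, fun x y => ?_⟩
  have hd := seqDist_nonneg x y
  have hdα : 0 ≤ seqDist x y ^ α := Real.rpow_nonneg hd α
  have hεα : 0 < ε ^ α := Real.rpow_pos_of_pos hε α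
  have hle : ∀ z, f z ≤ ‖f‖ := fun z => (le_abs_self _).trans (f.norm_coe_le_norm z)
  rw [add_mul]
  rcases lt_or_ge (seqDist x y) ε with h | h
  · have h1 := abs_sub_le_of_log_modulus (θ := fun t => H * t ^ α)
      (fun z => ⟨hf.1 z, hle z⟩) hf.2 h
    have h2 : (0 : ℝ) ≤ 2 * ‖f‖ / ε ^ α * seqDist x y ^ α := by positivity
    refine (h1.trans ?_).trans (le_add_of_nonneg_right h2)
    set s := H * seqDist x y ^ α with hs
    have hs0 : 0 ≤ s := by positivity
    have hsε : s ≤ H * ε ^ α :=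
      mul_le_mul_of_nonneg_left (Real.rpow_le_rpow hd h.le hα.le) hH
    have h3 : Real.exp s - 1 ≤ s * Real.exp (H * ε ^ α) := by
      have h4 : 1 - s ≤ Real.exp (-s) := by linarith [Real.add_one_le_exp (-s)]
      have h5 := mul_le_mul_of_nonneg_right h4 (Real.exp_pos s).le
      rw [← Real.exp_add, neg_add_cancel, Real.exp_zero] at h5
      have h6 := mul_le_mul_of_nonneg_left (Real.exp_le_exp.2 hsε) hs0
      linarith
    rw [abs_of_nonneg (by linarith [Real.add_one_le_exp s])]
    calc (Real.exp s - 1) * ‖f‖ ≤ s * Real.exp (H * ε ^ α) * ‖f‖ :=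
          mul_le_mul_of_nonneg_right h3 (norm_nonneg f)
      _ = _ := by rw [hs]; ring
  · have h1 : |f x - f y| ≤ 2 * ‖f‖ := by
      have := hle x; have := hle y; have := hf.1 x; have := hf.1 y
      rw [abs_le]; constructor <;> linarith [norm_nonneg f]
    have h2 : ε ^ α ≤ seqDist x y ^ α := Real.rpow_le_rpow hε.le h hα.le
    have h3 : 2 * ‖f‖ ≤ 2 * ‖f‖ / ε ^ α * seqDist x y ^ α := by
      rw [div_mul_eq_mul_div, le_div_iff₀ hεα]
      exact mul_le_mul_of_nonneg_left h2 (by positivity)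
    have h4 : 0 ≤ H * Real.exp (H * ε ^ α) * ‖f‖ * seqDist x y ^ α := by positivity
    linarith

/-- A modulus of continuity of a continuous function for the distance `seqDist`. -/
lemma exists_modulus (ψ : C(Adm A I, ℝ)) :
    ∃ ω : ℝ → ℝ, Tendsto ω (𝓝[≥] 0) (𝓝 0) ∧ (∀ t, 0 ≤ t → ω (t / 2) ≤ ω t) ∧
      ∀ x y, |ψ x - ψ y| ≤ ω (seqDist x y) := by
  set V : ℝ → Set ℝ := fun t => {r | ∃ x y : Adm A I, seqDist x y ≤ t ∧ r = |ψ x - ψ y|} with hV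
  have hbdd : ∀ t, BddAbove (V t) := fun t => ⟨2 * ‖ψ‖, by
    rintro _ ⟨x, y, -, rfl⟩
    have h1 := ψ.norm_coe_le_norm x
    have h2 := ψ.norm_coe_le_norm y
    rw [Real.norm_eq_abs] at h1 h2
    linarith [abs_sub (ψ x) (ψ y)]⟩
  have hnn : ∀ t, 0 ≤ sSup (V t) := fun t => Real.sSup_nonneg (by
    rintro _ ⟨x, y, -, rfl⟩; exact abs_nonneg _)
  refine ⟨fun t => sSup (V t), ?_, fun t ht => ?_, fun x y => le_csSup (hbdd _) ⟨x, y, le_rfl, rfl⟩⟩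
  · refine tendsto_order.2 ⟨fun a ha => Eventually.of_forall fun t => ha.trans_le (hnn t),
      fun a ha => ?_⟩
    -- a positive distance separates the pairs on which `ψ` varies by at least `a / 2`
    have hS : IsCompact {p : Adm A I × Adm A I | a / 2 ≤ |ψ p.1 - ψ p.2|} :=
      (isClosed_le continuous_const (by fun_prop)).isCompact
    obtain ⟨δ, hδ, hδS⟩ : ∃ δ > 0, ∀ p ∈ {p : Adm A I × Adm A I | a / 2 ≤ |ψ p.1 - ψ p.2|},
        δ ≤ seqDist p.1 p.2 := by
      rcases Set.eq_empty_or_nonempty {p : Adm A I × Adm A I | a / 2 ≤ |ψ p.1 - ψ p.2|} with h | h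
      · exact ⟨1, one_pos, fun p hp => by rw [h] at hp; exact hp.elim⟩
      · obtain ⟨p, hp, hmin⟩ := hS.exists_isMinOn h continuous_seqDist.continuousOn
        refine ⟨seqDist p.1 p.2, lt_of_le_of_ne (seqDist_nonneg _ _) fun h0 => ?_, fun q hq =>
          hmin hq⟩
        have hp' : a / 2 ≤ |ψ p.1 - ψ p.2| := hp
        rw [eq_of_seqDist_eq_zero h0.symm, sub_self, abs_zero] at hp'
        linarith
    filter_upwards [mem_nhdsWithin_of_mem_nhds (gt_mem_nhds hδ)] with t ht
    refine lt_of_le_of_lt (Real.sSup_le ?_ (by positivity : 0 ≤ a / 2)) (by linarith)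
    rintro _ ⟨x, y, hxy, rfl⟩
    by_contra! h
    have ht' : t < δ := ht
    have := hδS (x, y) h.le
    simp only at this
    linarith
  · rcases Set.eq_empty_or_nonempty (V (t / 2)) with h | h
    · simp only [h, Real.sSup_empty]; exact hnn t
    · refine csSup_le_csSup (hbdd t) h ?_
      rintro _ ⟨x, y, hxy, rfl⟩
      exact ⟨x, y, by linarith, rfl⟩

end Moduli

/-! ### Perron–Frobenius theory of the Ruelle operator -/

section PerronFrobenius

variable {M : Type*} [MetricSpace M] [CompactSpace M] {A : M → M → ℝ} {I : Set ℝ}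
  [CompactSpace (Adm A I)] [MeasurableSpace M] [BorelSpace M] (ν : Measure M)
  [IsProbabilityMeasure ν] [ν.IsOpenPosMeasure]

theorem exists_pos_eigenfunction (hB : IsIrreducibleSubshift A I) (φ : C(Adm A I, ℝ))
    {α C ε : ℝ} (hα : 0 < α) (hφ : ∀ x y, |φ x - φ y| ≤ C * seqDist x y ^ α) (hC : 0 ≤ C)
    (hε : 0 < ε)
    (hs : ∀ x y : Adm A I, seqDist x y < ε → secSet A I (x.1 0) = secSet A I (y.1 0)) :
    ∃ lam : ℝ, 0 < lam ∧ ∃ f ∈ logCone A I (fun t => C * logHolderFactor α * t ^ α) ε,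
      (∀ x, 0 < f x) ∧ transfer ν hB.isClopen φ f = lam • f := by
  have := hB.nonempty
  have hK := isCompactInvariantCone_logCone ν hB.isClopen φ hφ hε hs
    (tendsto_rpow_modulus hα (C * logHolderFactor α))
    fun t ht => (logHolderFactor_absorbs hα C ht).le
  refine (isIrreducible_transfer ν hB φ).exists_eigenfunction hK
    ⟨fun _ => zero_le_one, fun x y _ => ?_⟩
  simp only [ContinuousMap.one_apply, mul_one]
  refine Real.one_le_exp (mul_nonneg (mul_nonneg hC (logHolderFactor_nonneg hα)) ?_)
  exact Real.rpow_nonneg (seqDist_nonneg _ _) _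

lemma isMaximalEigenvalue_of_pos (hB : IsIrreducibleSubshift A I) (φ : C(Adm A I, ℝ))
    {α lam : ℝ} (hlam : 0 < lam) {f : C(Adm A I, ℝ)} (hfα : IsHolder seqDist α f)
    (hf : ∀ x, 0 < f x) (hfL : transfer ν hB.isClopen φ f = lam • f) :
    IsMaximalEigenvalue ν α φ lam := by
  have := hB.nonempty
  have hL := isIrreducible_transfer ν hB φ
  refine ⟨hlam, ⟨f, hfα, hf, (isEigen_iff_transfer ν hB.isClopen φ f lam).2 hfL⟩,
    fun g h hg hh hg0 hgL hhL => ?_, fun κ g hg hg0 hgL => ?_⟩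
  · obtain ⟨r, hr⟩ := hL.eigenfunction_unique hf hfL
      ((isEigen_iff_transfer ν hB.isClopen φ ⟨g, hg⟩ lam).1 hgL)
    obtain ⟨s, hs⟩ := hL.eigenfunction_unique hf hfL
      ((isEigen_iff_transfer ν hB.isClopen φ ⟨h, hh⟩ lam).1 hhL)
    have hgx : ∀ x, g x = r * f x := fun x => DFunLike.congr_fun hr x
    have hhx : ∀ x, h x = s * f x := fun x => DFunLike.congr_fun hs x
    have hr0 : r ≠ 0 := by
      rintro rfl
      exact hg0 (funext fun x => by simpa using hgx x)
    exact ⟨s / r, fun x => by rw [hgx, hhx]; field_simp⟩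
  · refine hL.abs_eigenvalue_le hf hfL
      ((isEigen_iff_transfer ν hB.isClopen φ ⟨g, hg⟩ κ).1 hgL) fun h => hg0 ?_
    exact funext fun x => DFunLike.congr_fun h x

omit [CompactSpace (Adm A I)] [BorelSpace M] [IsProbabilityMeasure ν] [ν.IsOpenPosMeasure] in
/-- A non-zero continuous eigenfunction bounds its eigenvalue by the maximal one. -/
lemma IsMaximalEigenvalue.le {α : ℝ} (hα : 0 < α) (hne : Nonempty (Adm A I))
    {φ : Adm A I → ℝ} {lam lam' : ℝ} (h : IsMaximalEigenvalue ν α φ lam)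
    (h' : IsMaximalEigenvalue ν α φ lam') : lam' ≤ lam := by
  obtain ⟨f, hfα, hf, hfL⟩ := h'.exists_eigenfunction
  obtain ⟨x⟩ := hne
  exact (le_abs_self _).trans (h.maximal lam' f (hfα.continuous hα)
    (fun h0 => (hf x).ne' (congrFun h0 x)) hfL)

omit [CompactSpace (Adm A I)] [BorelSpace M] [IsProbabilityMeasure ν] [ν.IsOpenPosMeasure] in
lemma IsMaximalEigenvalue.unique {α : ℝ} (hα : 0 < α) (hne : Nonempty (Adm A I))
    {φ : Adm A I → ℝ} {lam lam' : ℝ} (h : IsMaximalEigenvalue ν α φ lam)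
    (h' : IsMaximalEigenvalue ν α φ lam') : lam = lam' :=
  le_antisymm (h'.le ν hα hne h) (h.le ν hα hne h')

/-- The eigenfunctional of the dual operator is unique up to normalization. The general
continuous function is, up to an additive constant, a function `u ≥ 1`, and this lies in the cone
`logCone θ ε` for a `θ` that is built from a modulus of continuity of `u`. -/
theorem eigenfunctional_unique (hB : IsIrreducibleSubshift A I) (φ : C(Adm A I, ℝ))
    {α C lam : ℝ} (hα : 0 < α) (hφ : ∀ x y, |φ x - φ y| ≤ C * seqDist x y ^ α) (hC : 0 ≤ C)
    (hlam : 0 < lam) {f : C(Adm A I, ℝ)} (hf : ∀ x, 0 < f x)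
    (hfL : transfer ν hB.isClopen φ f = lam • f) (ℓ₁ ℓ₂ : C(Adm A I, ℝ) →L[ℝ] ℝ)
    (h₁ : ∀ ψ, ℓ₁ (transfer ν hB.isClopen φ ψ) = lam * ℓ₁ ψ)
    (h₂ : ∀ ψ, ℓ₂ (transfer ν hB.isClopen φ ψ) = lam * ℓ₂ ψ) (ψ : C(Adm A I, ℝ)) :
    ℓ₁ ψ * ℓ₂ f = ℓ₂ ψ * ℓ₁ f := by
  have := hB.nonempty
  obtain ⟨ε, hε, hs⟩ := exists_pos_forall_secSet_eq hB.locallyConstant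
  have hL := isIrreducible_transfer ν hB φ
  have key : ∀ u : C(Adm A I, ℝ), (∀ x, 1 ≤ u x) → ℓ₁ u * ℓ₂ f = ℓ₂ u * ℓ₁ f := fun u hu => by
    obtain ⟨ω, hω0, hω, hωu⟩ := exists_modulus u
    have hθ : Tendsto (fun t => ω t + C * logHolderFactor α * t ^ α) (𝓝[≥] 0) (𝓝 0) := by
      simpa using hω0.add (tendsto_rpow_modulus hα (C * logHolderFactor α))
    have hK := isCompactInvariantCone_logCone ν hB.isClopen φ hφ hε hs hθ fun t ht => by
      have := logHolderFactor_absorbs hα C ht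
      have := hω t ht
      linarith
    have hmem : u ∈ logCone A I (fun t => ω t + C * logHolderFactor α * t ^ α) ε := by
      refine ⟨fun x => zero_le_one.trans (hu x), fun x y _ => ?_⟩
      have h1 := (le_abs_self _).trans (hωu x y)
      have h2 : 0 ≤ ω (seqDist x y) := (abs_nonneg _).trans (hωu x y)
      have h3 : 0 ≤ C * logHolderFactor α * seqDist x y ^ α :=
        mul_nonneg (mul_nonneg hC (logHolderFactor_nonneg hα))
          (Real.rpow_nonneg (seqDist_nonneg _ _) _)
      have h4 := Real.add_one_le_exp (ω (seqDist x y) + C * logHolderFactor α * seqDist x y ^ α)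
      have h5 : ω (seqDist x y) ≤ ω (seqDist x y) * u y := le_mul_of_one_le_right h2 (hu y)
      calc u x ≤ (ω (seqDist x y) + 1) * u y := by linarith
        _ ≤ _ := mul_le_mul_of_nonneg_right (by linarith) (zero_le_one.trans (hu y))
    obtain ⟨r, hr⟩ := hL.exists_eigenfunctional_apply_eq hlam hf hfL hK hmem
    rw [hr ℓ₁ h₁, hr ℓ₂ h₂]
    ring
  have e1 := key 1 fun _ => le_rfl
  have e2 := key (ψ + (‖ψ‖ + 1) • 1) fun x => by
    have := neg_le_of_abs_le (ψ.norm_coe_le_norm x)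
    simp only [ContinuousMap.add_apply, ContinuousMap.smul_apply, ContinuousMap.one_apply,
      smul_eq_mul, mul_one]
    linarith
  simp only [map_add, map_smul, smul_eq_mul] at e2
  linear_combination e2 - (‖ψ‖ + 1) * e1

/-- Integration against a probability measure, as a functional on continuous functions. -/
noncomputable def integralCLM {X : Type*} [TopologicalSpace X] [CompactSpace X]
    [SecondCountableTopology X] [MeasurableSpace X] [OpensMeasurableSpace X] (m : Measure X)
    [IsProbabilityMeasure m] : C(X, ℝ) →L[ℝ] ℝ :=
  LinearMap.mkContinuous
    { toFun := fun ψ => ∫ x, ψ x ∂m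
      map_add' := fun u v => integral_add (integrable_of_continuous u.continuous)
        (integrable_of_continuous v.continuous)
      map_smul' := fun c u => integral_const_mul c _ }
    1 fun ψ => by
      simpa using norm_integral_le_of_norm_le_const (μ := m)
        (Eventually.of_forall fun x => ψ.norm_coe_le_norm x)

@[simp] lemma integralCLM_apply {X : Type*} [TopologicalSpace X] [CompactSpace X]
    [SecondCountableTopology X] [MeasurableSpace X] [OpensMeasurableSpace X] (m : Measure X)
    [IsProbabilityMeasure m] (ψ : C(X, ℝ)) : integralCLM m ψ = ∫ x, ψ x ∂m := rfl

omit [CompactSpace M] [CompactSpace (Adm A I)] [MeasurableSpace M] [BorelSpace M] in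
lemma continuous_normalized {φ f : Adm A I → ℝ} (hφ : Continuous φ) (hf : Continuous f)
    (hf0 : ∀ x, 0 < f x) (lam : ℝ) : Continuous (normalized φ f lam) := by
  have h1 : Continuous fun x => Real.log (f x) := hf.log fun x => (hf0 x).ne'
  exact ((hφ.add h1).sub (h1.comp continuous_shift)).sub continuous_const

omit [MetricSpace M] [CompactSpace M] [CompactSpace (Adm A I)] [BorelSpace M]
  [IsProbabilityMeasure ν] [ν.IsOpenPosMeasure] in
/-- Conjugation by `f` and division by `lam` normalizes the Ruelle operator. -/
lemma ruelle_normalized {φ f : Adm A I → ℝ} {lam : ℝ} (hlam : 0 < lam) (hf : ∀ x, 0 < f x)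
    (ψ : Adm A I → ℝ) (x : Adm A I) :
    ruelle ν (normalized φ f lam) ψ x = (lam * f x)⁻¹ * ruelle ν φ (fun z => f z * ψ z) x := by
  unfold ruelle
  rw [← integral_const_mul]
  refine integral_congr_ae (Eventually.of_forall fun a => ?_)
  have hsh : shift (cons a.1 x a.2) = x := rfl
  simp only [normalized, hsh, Real.exp_sub, Real.exp_add, Real.exp_log (hf _),
    Real.exp_log hlam]
  have := (hf x).ne'
  field_simp

theorem exists_eigenvalue_eigenprobability_gibbs (hB : IsIrreducibleSubshift A I) {α : ℝ}
    (hα : 0 < α) {φ : Adm A I → ℝ} (hφ : IsHolder seqDist α φ) :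
    ∃ lam ρ μ, IsMaximalEigenvalue ν α φ lam ∧ IsEigenprobability ν φ lam ρ ∧
      IsGibbsState ν α φ μ := by
  have := hB.nonempty
  obtain ⟨ε, hε, hs⟩ := exists_pos_forall_secSet_eq hB.locallyConstant
  obtain ⟨C, hC, hφC⟩ := hφ.exists_nonneg seqDist_nonneg
  let Φ : C(Adm A I, ℝ) := ⟨φ, hφ.continuous hα⟩
  obtain ⟨lam, hlam, f, hfc, hf, hfL⟩ := exists_pos_eigenfunction ν hB Φ hα hφC hC hε hs
  have hfα : IsHolder seqDist α f :=
    isHolder_of_mem_logCone hα (mul_nonneg hC (logHolderFactor_nonneg hα)) hε hfc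
  have hmax := isMaximalEigenvalue_of_pos ν hB Φ hlam hfα hf hfL
  have hfE : IsEigen ν φ lam f := (isEigen_iff_transfer ν hB.isClopen Φ f lam).2 hfL
  obtain ⟨ρ, hρ, hρL⟩ := (isIrreducible_transfer ν hB Φ).exists_eigenprobability hlam hf hfL
  let N : C(Adm A I, ℝ) :=
    ⟨normalized φ f lam, continuous_normalized Φ.continuous f.continuous hf lam⟩
  have hN : transfer ν hB.isClopen N 1 = (1 : ℝ) • 1 := by
    ext x
    have h1 : ruelle ν (normalized φ f lam) (1 : C(Adm A I, ℝ)) x = 1 := by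
      rw [ruelle_normalized ν hlam hf]
      simp only [ContinuousMap.one_apply, mul_one]
      rw [show ruelle ν φ (fun z => f z) x = lam * f x from hfE x,
        inv_mul_cancel₀ (mul_pos hlam (hf x)).ne']
    exact h1.trans (by simp)
  obtain ⟨μ, hμ, hμL⟩ := (isIrreducible_transfer ν hB N).exists_eigenprobability one_pos
    (fun _ => zero_lt_one) hN
  refine ⟨lam, ρ, μ, hmax, ⟨hρ, hρL⟩, hμ, lam, f, hmax, hfα, hf, hfE, fun ψ => ?_⟩
  exact (hμL ψ).trans (one_mul _)

/-- The Gibbs state is `g ρ` for every eigenprobability `ρ` and every eigenfunction `g`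
normalized by `ρ(g) = 1`. -/
theorem IsGibbsState.integral_eq (hB : IsIrreducibleSubshift A I) {α : ℝ} (hα : 0 < α)
    {φ : Adm A I → ℝ} (hφ : IsHolder seqDist α φ) {lam : ℝ} {ρ μ : Measure (Adm A I)}
    (hlam : IsMaximalEigenvalue ν α φ lam) (hρ : IsEigenprobability ν φ lam ρ)
    {g : Adm A I → ℝ} (hg : Continuous g) (hgL : IsEigen ν φ lam g) (hgρ : ∫ x, g x ∂ρ = 1)
    (hμ : IsGibbsState ν α φ μ) (ψ : C(Adm A I, ℝ)) : ∫ x, ψ x * g x ∂ρ = ∫ x, ψ x ∂μ := by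
  have := hB.nonempty
  have := hμ.prob
  have := hρ.prob
  obtain ⟨C, hC, hφC⟩ := hφ.exists_nonneg seqDist_nonneg
  obtain ⟨lam₀, f₀, hmax₀, hfα, hf, hfE, hfix⟩ := hμ.fixed
  obtain rfl := hlam.unique ν hα hB.nonempty hmax₀
  let Φ : C(Adm A I, ℝ) := ⟨φ, hφ.continuous hα⟩
  let f : C(Adm A I, ℝ) := ⟨f₀, hfα.continuous hα⟩
  let fi : C(Adm A I, ℝ) := ⟨fun x => (f₀ x)⁻¹, (hfα.continuous hα).inv₀ fun x => (hf x).ne'⟩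
  have hfL : transfer ν hB.isClopen Φ f = lam • f :=
    (isEigen_iff_transfer ν hB.isClopen Φ f lam).1 hfE
  have hmul : ∀ u : C(Adm A I, ℝ), (fun z => f₀ z * (fi * u) z) = u := fun u =>
    funext fun z => mul_inv_cancel_left₀ (hf z).ne' (u z)
  let ℓ : C(Adm A I, ℝ) →L[ℝ] ℝ := (integralCLM μ).comp (ContinuousLinearMap.mul ℝ _ fi)
  have hℓ : ∀ u, ℓ u = ∫ x, (fi * u) x ∂μ := fun u => rfl
  have hℓL : ∀ u, ℓ (transfer ν hB.isClopen Φ u) = lam * ℓ u := fun u => by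
    rw [hℓ, hℓ, ← hfix (fi * u), ← integral_const_mul]
    refine integral_congr_ae (Eventually.of_forall fun x => ?_)
    simp only [ruelle_normalized ν hlam.pos hf, hmul]
    show (f₀ x)⁻¹ * ruelle ν φ u x = lam * ((lam * f₀ x)⁻¹ * ruelle ν φ u x)
    have := hlam.pos.ne'
    rw [mul_inv]
    field_simp
  have h1 := eigenfunctional_unique ν hB Φ hα hφC hC hlam.pos (f := f) hf hfL ℓ (integralCLM ρ)
    hℓL (fun u => hρ.eigen u) (f * ψ)
  have e1 : fi * (f * ψ) = ψ := by
    ext x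
    simp [fi, f, (hf x).ne']
  have e2 : fi * f = 1 := by
    ext x
    simp [fi, f, (hf x).ne']
  rw [hℓ, hℓ, e1, e2, integralCLM_apply, integralCLM_apply] at h1
  simp only [ContinuousMap.one_apply, integral_const, probReal_univ, smul_eq_mul, mul_one] at h1
  obtain ⟨r, hr⟩ := (isIrreducible_transfer ν hB Φ).eigenfunction_unique (f := f) hf hfL
    ((isEigen_iff_transfer ν hB.isClopen Φ ⟨g, hg⟩ lam).1 hgL)
  have hgx : ∀ x, g x = r * f x := fun x => DFunLike.congr_fun hr x
  simp only [hgx, integral_const_mul] at hgρ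
  calc ∫ x, ψ x * g x ∂ρ = ∫ x, r * (f * ψ) x ∂ρ :=
        integral_congr_ae (Eventually.of_forall fun x => by
          simp only [hgx, ContinuousMap.mul_apply]; ring)
    _ = r * ∫ x, (f * ψ) x ∂ρ := integral_const_mul _ _
    _ = (r * ∫ x, f x ∂ρ) * ∫ x, ψ x ∂μ := by rw [← h1]; ring
    _ = ∫ x, ψ x ∂μ := by rw [hgρ, one_mul]

end PerronFrobenius

/-! ### Duality by the involution kernel -/

section Duality

variable {M : Type*} [MetricSpace M] [CompactSpace M] [MeasurableSpace M] [BorelSpace M]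
  (ν : Measure M) [IsProbabilityMeasure ν] {I : Set ℝ}

/-- If a kernel `K` intertwines the potentials `φ` and `φ'` by
`e^{φ(ax)} K(y, ax) = e^{φ'(ay)} K(ay, x)`, then integration of `K` against an eigenmeasure of
`L_{φ'}` is an eigenfunction of `L_φ`, by Fubini. The hypothesis and hence the conclusion are
symmetric in the two subshifts. -/
theorem isEigen_integral_kernel {A A' : M → M → ℝ} [CompactSpace (Adm A I)]
    [CompactSpace (Adm A' I)] (hR : IsClopen {p : M × M | A p.1 p.2 ∈ I})
    (hR' : IsClopen {p : M × M | A' p.1 p.2 ∈ I}) (φ : C(Adm A I, ℝ)) (φ' : C(Adm A' I, ℝ))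
    {K : Adm A' I → Adm A I → ℝ} (hK : Continuous fun p : Adm A' I × Adm A I => K p.1 p.2)
    (hdual : ∀ a x y, extCons (fun z => Real.exp (φ z) * K y z) a x
      = extCons (fun z => Real.exp (φ' z) * K z x) a y)
    {lam' : ℝ} {ρ' : Measure (Adm A' I)} (hρ' : IsEigenprobability ν φ' lam' ρ') :
    IsEigen ν φ lam' fun x => ∫ y, K y x ∂ρ' := by
  have := hρ'.prob
  intro x
  have hKx : ∀ x, Continuous fun y => K y x := fun x =>
    hK.comp (continuous_id.prodMk continuous_const)
  have hjoint : Continuous fun p : M × Adm A' I =>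
      extCons (fun z => Real.exp (φ' z) * K z x) p.1 p.2 :=
    continuous_extCons hR' ((by fun_prop : Continuous fun z => Real.exp (φ' z)).mul (hKx x))
  calc ruelle ν φ (fun x => ∫ y, K y x ∂ρ') x
      = ∫ a, extCons (fun z => Real.exp (φ z) * ∫ y, K y z ∂ρ') a x ∂ν :=
        ruelle_eq_integral ν hR _ _ x
    _ = ∫ a, ∫ y, extCons (fun z => Real.exp (φ' z) * K z x) a y ∂ρ' ∂ν := by
        refine integral_congr_ae (Eventually.of_forall fun a => ?_)
        simp only [← hdual]
        by_cases ha : A a (x.1 0) ∈ I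
        · simp only [extCons_of_mem _ ha, integral_const_mul]
        · simp only [extCons_of_notMem _ ha, integral_zero]
    _ = ∫ y, ∫ a, extCons (fun z => Real.exp (φ' z) * K z x) a y ∂ν ∂ρ' :=
        integral_integral_swap (integrable_of_continuous hjoint)
    _ = ∫ y, ruelle ν φ' (fun z => K z x) y ∂ρ' := by
        simp only [ruelle_eq_integral ν hR']
    _ = lam' * ∫ y, K y x ∂ρ' := hρ'.eigen ⟨_, hKx x⟩

variable {A : M → M → ℝ}

omit [MetricSpace M] [CompactSpace M] [MeasurableSpace M] [BorelSpace M] in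
lemma expKernel_of_mem (W : Hat A I → ℝ) {y : Adm (transpose A) I} {x : Adm A I}
    (h : A (y.1 0) (x.1 0) ∈ I) : expKernel W y x = Real.exp (W ⟨(y, x), h⟩) := dif_pos h

omit [MetricSpace M] [CompactSpace M] [MeasurableSpace M] [BorelSpace M] in
lemma expKernel_of_notMem (W : Hat A I → ℝ) {y : Adm (transpose A) I} {x : Adm A I}
    (h : A (y.1 0) (x.1 0) ∉ I) : expKernel W y x = 0 := dif_neg h

omit [MetricSpace M] [CompactSpace M] [MeasurableSpace M] [BorelSpace M] in
lemma expKernel_nonneg (W : Hat A I → ℝ) (y : Adm (transpose A) I) (x : Adm A I) :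
    0 ≤ expKernel W y x := by
  unfold expKernel; split_ifs <;> positivity

omit [MetricSpace M] [CompactSpace M] [MeasurableSpace M] [BorelSpace M] in
lemma expKernel_sub_const (W : Hat A I → ℝ) (c : ℝ) (y : Adm (transpose A) I) (x : Adm A I) :
    expKernel (fun p => W p - c) y x = (Real.exp c)⁻¹ * expKernel W y x := by
  unfold expKernel
  split_ifs
  · rw [Real.exp_sub, div_eq_inv_mul]
  · rw [mul_zero]

omit [CompactSpace M] [MeasurableSpace M] [BorelSpace M] in
lemma isClopen_admissible_pairs (hR : IsClopen {p : M × M | A p.1 p.2 ∈ I}) :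
    IsClopen {p : Adm (transpose A) I × Adm A I | A (p.1.1 0) (p.2.1 0) ∈ I} := by
  have hc : Continuous fun p : Adm (transpose A) I × Adm A I => (p.1.1 0, p.2.1 0) :=
    ((continuous_coord 0).comp continuous_fst).prodMk ((continuous_coord 0).comp continuous_snd)
  exact hR.preimage hc

omit [CompactSpace M] [MeasurableSpace M] [BorelSpace M] in
lemma continuous_expKernel (hR : IsClopen {p : M × M | A p.1 p.2 ∈ I}) {W : Hat A I → ℝ}
    (hW : Continuous W) :
    Continuous fun p : Adm (transpose A) I × Adm A I => expKernel W p.1 p.2 := by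
  classical
  have := continuous_dite_of_isClopen (isClopen_admissible_pairs hR)
    (F := fun p h => Real.exp (W ⟨p, h⟩)) (Real.continuous_exp.comp hW)
  refine this.congr fun p => ?_
  unfold expKernel
  congr

omit [MetricSpace M] [CompactSpace M] [MeasurableSpace M] [BorelSpace M] in
/-- The cohomological equation between `φ`, `φ'` and `W`, in multiplicative form. -/
lemma IsInvolutionKernel.extCons_eq {φ : Adm A I → ℝ} {φ' : Adm (transpose A) I → ℝ}
    {W : Hat A I → ℝ} (h : IsInvolutionKernel φ φ' W) (a : M) (x : Adm A I)
    (y : Adm (transpose A) I) :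
    extCons (fun z => Real.exp (φ z) * expKernel W y z) a x
      = extCons (fun z => Real.exp (φ' z) * expKernel W z x) a y := by
  by_cases hx : A a (x.1 0) ∈ I
  · by_cases hy : transpose A a (y.1 0) ∈ I
    · have e1 : expKernel W y (cons a x hx) = Real.exp (W ⟨(y, cons a x hx), hy⟩) :=
        expKernel_of_mem W (x := cons a x hx) hy
      have e2 : expKernel W (cons a y hy) x = Real.exp (W ⟨(cons a y hy, x), hx⟩) :=
        expKernel_of_mem W (y := cons a y hy) hx
      rw [extCons_of_mem _ hx, extCons_of_mem _ hy, e1, e2, ← Real.exp_add, ← Real.exp_add]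
      have h1 : φ' (cons a y hy) = φ (cons a x hx) + W ⟨(y, cons a x hx), hy⟩
          - W ⟨(cons a y hy, x), hx⟩ := h ⟨(cons a y hy, x), hx⟩
      rw [h1, sub_add_cancel]
    · rw [extCons_of_mem _ hx, extCons_of_notMem _ hy,
        expKernel_of_notMem W (x := cons a x hx) hy, mul_zero]
  · by_cases hy : transpose A a (y.1 0) ∈ I
    · rw [extCons_of_notMem _ hx, extCons_of_mem _ hy,
        expKernel_of_notMem W (y := cons a y hy) hx, mul_zero]
    · rw [extCons_of_notMem _ hx, extCons_of_notMem _ hy]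

section BilateralMeasure

variable [CompactSpace (Adm A I)] [CompactSpace (Adm (transpose A) I)]

omit [CompactSpace (Adm A I)] [CompactSpace (Adm (transpose A) I)] in
/-- Integration against the bilateral measure. -/
lemma integral_bilateralMeasure (hR : IsClopen {p : M × M | A p.1 p.2 ∈ I}) {W : Hat A I → ℝ}
    (hW : Continuous W) (ρ' : Measure (Adm (transpose A) I)) (ρ : Measure (Adm A I))
    (g : Adm (transpose A) I × Adm A I → ℝ) :
    ∫ p, g p.1 ∂(bilateralMeasure W ρ' ρ)
      = ∫ p, g p * expKernel (fun p => W p - logConst W ρ' ρ) p.1 p.2 ∂(ρ'.prod ρ) := by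
  set c := logConst W ρ' ρ with hc
  have hm : Measurable fun p : Hat A I => ENNReal.ofReal (Real.exp (W p - c)) :=
    (ENNReal.continuous_ofReal.comp (Real.continuous_exp.comp (hW.sub continuous_const))).measurable
  rw [bilateralMeasure, integral_withDensity_eq_integral_toReal_smul hm
    (Eventually.of_forall fun p => ENNReal.ofReal_lt_top)]
  have h1 : ∀ p : Hat A I, (ENNReal.ofReal (Real.exp (W p - c))).toReal • g p.1
      = g p.1 * expKernel (fun p => W p - c) p.1.1 p.1.2 := fun p => by
    rw [ENNReal.toReal_ofReal (Real.exp_pos _).le, expKernel_of_mem _ p.2, smul_eq_mul, mul_comm]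
  simp only [h1]
  have hmeas : MeasurableSet
      {p : Adm (transpose A) I × Adm A I | A (p.1.1 0) (p.2.1 0) ∈ I} :=
    (isClopen_admissible_pairs hR).1.measurableSet
  refine (integral_subtype_comap hmeas
    (fun p => g p * expKernel (fun p => W p - c) p.1 p.2)).trans ?_
  refine setIntegral_eq_integral_of_forall_compl_eq_zero fun p hp => ?_
  rw [expKernel_of_notMem _ hp, mul_zero]

variable [ν.IsOpenPosMeasure]

omit [CompactSpace (Adm A I)] in
lemma integral_expKernel_left_pos (hB : IsIrreducibleSubshift A I)
    (hB' : IsIrreducibleSubshift (transpose A) I) {W : Hat A I → ℝ} (hW : Continuous W)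
    (φ' : C(Adm (transpose A) I, ℝ)) {lam' : ℝ} {ρ' : Measure (Adm (transpose A) I)}
    (hρ' : IsEigenprobability ν φ' lam' ρ') (x : Adm A I) : 0 < ∫ y, expKernel W y x ∂ρ' := by
  have := hρ'.prob
  have hc : Continuous fun y => expKernel W y x :=
    (continuous_expKernel hB.isClopen hW).comp (continuous_id.prodMk continuous_const)
  refine (isIrreducible_transfer ν hB' φ').integral_pos_of_eigenmeasure (fun u => hρ'.eigen u)
    (u := ⟨_, hc⟩) (fun y => expKernel_nonneg W y x) fun h => ?_
  -- `x` has an infinite backward orbit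
  choose g hg using hB.exists_preimage
  let u : ℕ → Adm A I := fun n => Nat.rec (cons (g x) x (hg x)) (fun _ x => cons (g x) x (hg x)) n
  have hu : ∀ n, A ((u (n + 1)).1 0) ((u n).1 0) ∈ I := fun n => hg (u n)
  let y : Adm (transpose A) I := ⟨fun n => (u n).1 0, hu⟩
  have hy : A (y.1 0) (x.1 0) ∈ I := hg x
  have h0 : expKernel W y x = 0 := DFunLike.congr_fun h y
  rw [expKernel_of_mem W hy] at h0
  exact (Real.exp_pos _).ne' h0

omit [CompactSpace (Adm (transpose A) I)] in
lemma integral_expKernel_right_pos (hB : IsIrreducibleSubshift A I)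
    (hext : ∀ y : Adm (transpose A) I, ∃ x : Adm A I, A (y.1 0) (x.1 0) ∈ I) {W : Hat A I → ℝ}
    (hW : Continuous W) (φ : C(Adm A I, ℝ)) {lam : ℝ} {ρ : Measure (Adm A I)}
    (hρ : IsEigenprobability ν φ lam ρ) (y : Adm (transpose A) I) :
    0 < ∫ x, expKernel W y x ∂ρ := by
  have := hρ.prob
  have hc : Continuous fun x => expKernel W y x :=
    (continuous_expKernel hB.isClopen hW).comp (continuous_const.prodMk continuous_id)
  refine (isIrreducible_transfer ν hB φ).integral_pos_of_eigenmeasure (fun u => hρ.eigen u)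
    (u := ⟨_, hc⟩) (fun x => expKernel_nonneg W y x) fun h => ?_
  obtain ⟨x, hx⟩ := hext y
  have h0 : expKernel W y x = 0 := DFunLike.congr_fun h x
  rw [expKernel_of_mem W hx] at h0
  exact (Real.exp_pos _).ne' h0

/-- The eigenfunctions that the involution kernel provides, and the bilateral measure in terms of
them. -/
theorem bilateral_eigenfunctions (hB : IsIrreducibleSubshift A I)
    (hB' : IsIrreducibleSubshift (transpose A) I)
    (hext : ∀ y : Adm (transpose A) I, ∃ x : Adm A I, A (y.1 0) (x.1 0) ∈ I)
    {φ : Adm A I → ℝ} {φ' : Adm (transpose A) I → ℝ} {W : Hat A I → ℝ} (hφ : Continuous φ)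
    (hφ' : Continuous φ') (hW : Continuous W) (hdual : IsInvolutionKernel φ φ' W)
    {lam lam' : ℝ} {ρ : Measure (Adm A I)} {ρ' : Measure (Adm (transpose A) I)}
    (hρ : IsEigenprobability ν φ lam ρ) (hρ' : IsEigenprobability ν φ' lam' ρ') :
    (Continuous (eigenfun W ρ' ρ) ∧ (∀ x, 0 < eigenfun W ρ' ρ x) ∧
      IsEigen ν φ lam' (eigenfun W ρ' ρ) ∧ ∫ x, eigenfun W ρ' ρ x ∂ρ = 1) ∧
    (Continuous (eigenfunStar W ρ' ρ) ∧ (∀ y, 0 < eigenfunStar W ρ' ρ y) ∧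
      IsEigen ν φ' lam (eigenfunStar W ρ' ρ) ∧ ∫ y, eigenfunStar W ρ' ρ y ∂ρ' = 1) ∧
    lam = lam' ∧ IsProbabilityMeasure (bilateralMeasure W ρ' ρ) ∧
    (∀ ψ : C(Adm A I, ℝ), ∫ p, ψ p.1.2 ∂(bilateralMeasure W ρ' ρ)
      = ∫ x, ψ x * eigenfun W ρ' ρ x ∂ρ) ∧
    (∀ ψ : C(Adm (transpose A) I, ℝ), ∫ p, ψ p.1.1 ∂(bilateralMeasure W ρ' ρ)
      = ∫ y, ψ y * eigenfunStar W ρ' ρ y ∂ρ') := by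
  have := hρ.prob
  have := hρ'.prob
  set c := logConst W ρ' ρ with hc
  have hWc : Continuous fun p => W p - c := hW.sub continuous_const
  have hK := continuous_expKernel hB.isClopen hWc
  have hd : IsInvolutionKernel φ φ' fun p => W p - c := fun p => by
    rw [hdual p]; ring
  have hposx := integral_expKernel_left_pos ν hB hB' hWc ⟨φ', hφ'⟩ hρ'
  have hposy := integral_expKernel_right_pos ν hB hext hWc ⟨φ, hφ⟩ hρ
  have hcx : Continuous (eigenfun W ρ' ρ) := continuous_integral_left ρ' hK
  have hcy : Continuous (eigenfunStar W ρ' ρ) :=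
    continuous_integral_left (g := fun x y => expKernel (fun p => W p - c) y x) ρ
      (hK.comp continuous_swap)
  have hex : IsEigen ν φ lam' (eigenfun W ρ' ρ) :=
    isEigen_integral_kernel ν hB.isClopen hB'.isClopen ⟨φ, hφ⟩ ⟨φ', hφ'⟩ hK
      (fun a x y => hd.extCons_eq a x y) hρ'
  have hey : IsEigen ν φ' lam (eigenfunStar W ρ' ρ) :=
    isEigen_integral_kernel (K := fun x y => expKernel (fun p => W p - c) y x) ν hB'.isClopen
      hB.isClopen ⟨φ', hφ'⟩ ⟨φ, hφ⟩ (hK.comp continuous_swap)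
      (fun a y x => (hd.extCons_eq a x y).symm) hρ
  have hint : Integrable (fun p : Adm (transpose A) I × Adm A I =>
      expKernel (fun p => W p - c) p.1 p.2) (ρ'.prod ρ) := integrable_of_continuous hK
  have htot : ∫ p, expKernel (fun p => W p - c) p.1 p.2 ∂(ρ'.prod ρ) = 1 := by
    have hZ : 0 < ∫ p, expKernel W p.1 p.2 ∂(ρ'.prod ρ) := by
      have hKW := continuous_expKernel hB.isClopen hW
      rw [integral_prod_symm _ (integrable_of_continuous hKW)]
      have hg : Continuous fun x => ∫ y, expKernel W y x ∂ρ' := continuous_integral_left ρ' hKW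
      have hg0 := integral_expKernel_left_pos ν hB hB' hW ⟨φ', hφ'⟩ hρ'
      refine (integral_pos_iff_support_of_nonneg (fun x => (hg0 x).le)
        (integrable_of_continuous hg)).2 ?_
      have : Function.support (fun x => ∫ y, expKernel W y x ∂ρ') = Set.univ :=
        Set.eq_univ_of_forall fun x => (hg0 x).ne'
      rw [this, measure_univ]
      exact one_pos
    simp only [expKernel_sub_const, integral_const_mul]
    rw [hc, logConst, Real.exp_log hZ, inv_mul_cancel₀ hZ.ne']
  have hix : ∫ x, eigenfun W ρ' ρ x ∂ρ = 1 := by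
    rw [← htot, integral_prod_symm _ hint]; rfl
  have hiy : ∫ y, eigenfunStar W ρ' ρ y ∂ρ' = 1 := by
    rw [← htot, integral_prod _ hint]; rfl
  refine ⟨⟨hcx, hposx, hex, hix⟩, ⟨hcy, hposy, hey, hiy⟩, ?_, ?_, fun ψ => ?_, fun ψ => ?_⟩
  · have h1 := hρ.eigen ⟨_, hcx⟩
    simp only [ContinuousMap.coe_mk] at h1
    rw [integral_congr_ae (Eventually.of_forall hex), integral_const_mul, hix] at h1
    simpa using h1.symm
  · have h1 := integral_bilateralMeasure hB.isClopen hW ρ' ρ fun _ => 1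
    simp only [one_mul, integral_const, smul_eq_mul, mul_one] at h1
    rw [← hc, htot] at h1
    exact ⟨(ENNReal.toReal_eq_one_iff _).1 h1⟩
  · have hi : Integrable (fun p : Adm (transpose A) I × Adm A I =>
        ψ p.2 * expKernel (fun p => W p - c) p.1 p.2) (ρ'.prod ρ) :=
      integrable_of_continuous ((ψ.continuous.comp continuous_snd).mul hK)
    rw [integral_bilateralMeasure hB.isClopen hW ρ' ρ fun p => ψ p.2, ← hc,
      integral_prod_symm _ hi]
    simp only [integral_const_mul]
    rfl
  · have hi : Integrable (fun p : Adm (transpose A) I × Adm A I =>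
        ψ p.1 * expKernel (fun p => W p - c) p.1 p.2) (ρ'.prod ρ) :=
      integrable_of_continuous ((ψ.continuous.comp continuous_fst).mul hK)
    rw [integral_bilateralMeasure hB.isClopen hW ρ' ρ fun p => ψ p.1, ← hc,
      integral_prod _ hi]
    simp only [integral_const_mul]
    rfl

end BilateralMeasure

end Duality

/-! ### Pressure and invariant measures -/

section Pressure

lemma exists_pos_le_measureReal_ball {M : Type*} [MetricSpace M] [CompactSpace M]
    [MeasurableSpace M] [BorelSpace M] (ν : Measure M) [IsProbabilityMeasure ν] [ν.IsOpenPosMeasure] {δ : ℝ}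
    (hδ : 0 < δ) : ∃ c : ℝ, 0 < c ∧ ∀ a, c ≤ ν.real (Metric.ball a δ) := by
  obtain ⟨t, -, ht, hcov⟩ := finite_cover_balls_of_compact (isCompact_univ (X := M)) (half_pos hδ)
  have hpos : ∀ a, 0 < ν.real (Metric.ball a (δ / 2)) := fun a =>
    ENNReal.toReal_pos
      (Metric.isOpen_ball.measure_pos ν ⟨a, Metric.mem_ball_self (half_pos hδ)⟩).ne'
      (measure_ne_top _ _)
  have hne : t.Nonempty := by
    by_contra h
    rw [Set.not_nonempty_iff_eq_empty] at h
    have hM : (Set.univ : Set M) = ∅ := by simpa [h] using hcov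
    have h1 : ν Set.univ = 1 := measure_univ
    rw [hM] at h1
    simp at h1
  obtain ⟨b, hb, hmin⟩ := Set.exists_min_image t (fun a => ν.real (Metric.ball a (δ / 2))) ht hne
  refine ⟨_, hpos b, fun a => ?_⟩
  obtain ⟨i, hi, hai⟩ := Set.mem_iUnion₂.1 (hcov (Set.mem_univ a))
  refine (hmin i hi).trans (measureReal_mono fun z hz => ?_)
  rw [Metric.mem_ball] at *
  linarith [dist_triangle z i a, dist_comm a i]

variable {M : Type*} [MetricSpace M] [CompactSpace M] [MeasurableSpace M] [BorelSpace M]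
  (ν : Measure M) [IsProbabilityMeasure ν] {A : M → M → ℝ} {I : Set ℝ} [CompactSpace (Adm A I)]

omit [MetricSpace M] [CompactSpace M] [CompactSpace (Adm A I)] [BorelSpace M]
  [IsProbabilityMeasure ν] in
lemma ruelle_comp_shift_mul (φ ψ f : Adm A I → ℝ) (x : Adm A I) :
    ruelle ν φ (fun z => ψ (shift z) * f z) x = ψ x * ruelle ν φ f x := by
  unfold ruelle
  rw [← integral_const_mul]
  refine integral_congr_ae (Eventually.of_forall fun a => ?_)
  have hsh : shift (cons a.1 x a.2) = x := rfl
  simp only [hsh]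
  ring

omit [CompactSpace M] [CompactSpace (Adm A I)] [BorelSpace M] [IsProbabilityMeasure ν] in
/-- The measure `f ρ` is invariant under the shift. -/
lemma integral_comp_shift_mul {φ : Adm A I → ℝ} {lam : ℝ} {ρ : Measure (Adm A I)}
    (hlam : lam ≠ 0) (hρ : IsEigenprobability ν φ lam ρ) {f : Adm A I → ℝ} (hf : Continuous f)
    (hfL : IsEigen ν φ lam f) (ψ : C(Adm A I, ℝ)) :
    ∫ x, ψ (shift x) * f x ∂ρ = ∫ x, ψ x * f x ∂ρ := by
  have h := hρ.eigen ⟨fun x => ψ (shift x) * f x, (ψ.continuous.comp continuous_shift).mul hf⟩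
  simp only [ContinuousMap.coe_mk, ruelle_comp_shift_mul ν φ ψ f, hfL _] at h
  refine mul_left_cancel₀ hlam ?_
  rw [← h, ← integral_const_mul]
  refine integral_congr_ae (Eventually.of_forall fun x => ?_)
  simp only
  ring

omit [IsProbabilityMeasure ν] in
/-- The tangent inequality for the pressure `log lam`, from `e^h ≥ 1 + h` for the difference
`h` of the two normalized potentials. -/
theorem log_add_integral_le_log {φ χ : C(Adm A I, ℝ)} {lam lam₁ : ℝ} {ρ : Measure (Adm A I)}
    (hlam : 0 < lam) (hρ : IsEigenprobability ν χ lam ρ) {f : Adm A I → ℝ} (hf : Continuous f)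
    (hf0 : ∀ x, 0 < f x) (hfL : IsEigen ν χ lam f) (hfρ : ∫ x, f x ∂ρ = 1) (hlam₁ : 0 < lam₁)
    {f₁ : Adm A I → ℝ} (hf₁ : Continuous f₁) (hf₁0 : ∀ x, 0 < f₁ x) (hf₁L : IsEigen ν φ lam₁ f₁) :
    Real.log lam + ∫ x, (φ x - χ x) * f x ∂ρ ≤ Real.log lam₁ := by
  have := hρ.prob
  obtain ⟨g, hg⟩ : ∃ g : C(Adm A I, ℝ), ∀ x, g x = Real.log (f₁ x) - Real.log (f x) :=
    ⟨⟨_, (hf₁.log fun x => (hf₁0 x).ne').sub (hf.log fun x => (hf0 x).ne')⟩, fun _ => rfl⟩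
  obtain ⟨h, hh⟩ : ∃ h : C(Adm A I, ℝ), ∀ x, h x = (φ x - χ x)
      + (Real.log lam - Real.log lam₁) + (g x - g (shift x)) :=
    ⟨⟨fun x => (φ x - χ x) + (Real.log lam - Real.log lam₁) + (g x - g (shift x)),
      by fun_prop⟩, fun _ => rfl⟩
  have hL : ∀ x, ruelle ν χ (fun z => Real.exp (h z) * f z) x = lam * f x := fun x => by
    have e : ruelle ν χ (fun z => Real.exp (h z) * f z) x
        = lam * f x / (lam₁ * f₁ x) * ruelle ν φ f₁ x := by
      unfold ruelle
      rw [← integral_const_mul]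
      refine integral_congr_ae (Eventually.of_forall fun a => ?_)
      have hsh : shift (cons a.1 x a.2) = x := rfl
      have e1 : ∀ z, f₁ z = Real.exp (Real.log (f₁ z)) := fun z => (Real.exp_log (hf₁0 z)).symm
      have e2 : ∀ z, f z = Real.exp (Real.log (f z)) := fun z => (Real.exp_log (hf0 z)).symm
      have e3 : lam * f x / (lam₁ * f₁ x) = Real.exp (Real.log lam + Real.log (f x)
          - (Real.log lam₁ + Real.log (f₁ x))) := by
        rw [Real.exp_sub, Real.exp_add, Real.exp_add, Real.exp_log hlam, Real.exp_log hlam₁,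
          ← e1, ← e2]
      simp only [e3]
      rw [e1 (cons a.1 x a.2), e2 (cons a.1 x a.2), ← Real.exp_add, ← Real.exp_add,
        ← Real.exp_add, ← Real.exp_add]
      congr 1
      simp only [hh, hg, hsh]
      ring
    rw [e, hf₁L x]
    have := hlam₁.ne'
    have := (hf₁0 x).ne'
    field_simp
  have hint : ∫ x, Real.exp (h x) * f x ∂ρ = 1 := by
    have h1 := hρ.eigen ⟨fun z => Real.exp (h z) * f z, by fun_prop⟩
    simp only [ContinuousMap.coe_mk, hL, integral_const_mul, hfρ] at h1
    exact (mul_left_cancel₀ hlam.ne' h1).symm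
  have hle : ∫ x, (h x + 1) * f x ∂ρ ≤ ∫ x, Real.exp (h x) * f x ∂ρ :=
    integral_mono (integrable_of_continuous (by fun_prop)) (integrable_of_continuous (by fun_prop))
      fun x => mul_le_mul_of_nonneg_right (Real.add_one_le_exp _) (hf0 x).le
  have hgi := integral_comp_shift_mul ν hlam.ne' hρ hf hfL g
  have hexp : ∫ x, (h x + 1) * f x ∂ρ = ∫ x, (φ x - χ x) * f x ∂ρ
      + (Real.log lam - Real.log lam₁ + 1) := by
    have e : ∀ x, (h x + 1) * f x = (φ x - χ x) * f x + (Real.log lam - Real.log lam₁ + 1) * f x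
        + (g x * f x - g (shift x) * f x) := fun x => by
      simp only [hh]; ring
    simp only [e]
    rw [integral_add (integrable_of_continuous (by fun_prop))
        (integrable_of_continuous (by fun_prop)),
      integral_add (integrable_of_continuous (by fun_prop))
        (integrable_of_continuous (by fun_prop)),
      integral_sub (integrable_of_continuous (by fun_prop))
        (integrable_of_continuous (by fun_prop)), hgi, integral_const_mul, hfρ]
    ring
  rw [hexp, hint] at hle
  linarith

variable [ν.IsOpenPosMeasure]

/-- The integrals of `φ` against invariant measures are at most `log lam`, up to an error that
depends on `φ` through its Hölder constant `C` only: with `f` the positive eigenfunction,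
`φ + log f - log (f ∘ σ)` is at most `log lam` plus this error, since the integral that defines
`L_φ f` is bounded below by its part over a ball. -/
theorem exists_integral_le_log_add (hB : IsIrreducibleSubshift A I)
    (hs' : IsLocallyConstant (secSet (transpose A) I)) {α κ : ℝ} (hα : 0 < α) (hκ : 0 < κ) :
    ∃ b : ℝ, ∀ (φ : C(Adm A I, ℝ)) (C lam : ℝ), 0 ≤ C →
      (∀ x y, |φ x - φ y| ≤ C * seqDist x y ^ α) → IsMaximalEigenvalue ν α φ lam →
      ∀ μ : Measure (Adm A I), IsProbabilityMeasure μ → MeasurePreserving shift μ μ →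
        ∫ x, φ x ∂μ ≤ Real.log lam + C * κ + b := by
  obtain ⟨ε, hε, hs⟩ := exists_pos_forall_secSet_eq hB.locallyConstant
  obtain ⟨δ₁, hδ₁, hsec⟩ := exists_pos_forall_dist_lt_secSet_eq hs'
  -- a radius `δ` at which the local variation of `φ + log f` is at most `C κ`
  obtain ⟨δ₂, hδ₂, hδκ⟩ : ∃ δ₂ > 0, (1 + logHolderFactor α) * δ₂ ^ α ≤ κ := by
    have h := tendsto_rpow_modulus hα (1 + logHolderFactor α)
    have h' : Tendsto (fun t : ℝ => (1 + logHolderFactor α) * t ^ α) (𝓝[>] 0) (𝓝 0) :=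
      h.mono_left (nhdsWithin_mono _ Set.Ioi_subset_Ici_self)
    obtain ⟨t, ht, ht0⟩ := ((h'.eventually (gt_mem_nhds hκ)).and self_mem_nhdsWithin).exists
    exact ⟨t, ht0, ht.le⟩
  set δ := min (min ε δ₁) δ₂ with hδdef
  have hδ : 0 < δ := lt_min (lt_min hε hδ₁) hδ₂
  have hδε : δ ≤ ε := (min_le_left _ _).trans (min_le_left _ _)
  have hδδ₁ : δ ≤ δ₁ := (min_le_left _ _).trans (min_le_right _ _)
  obtain ⟨c, hc, hball⟩ := exists_pos_le_measureReal_ball ν hδ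
  refine ⟨-Real.log c, fun φ C lam hC hφ hlam μ hμ hinv => ?_⟩
  obtain ⟨lam₁, hlam₁, f, hfc, hf, hfL⟩ := exists_pos_eigenfunction ν hB φ hα hφ hC hε hs
  obtain rfl := hlam.unique ν hα hB.nonempty (isMaximalEigenvalue_of_pos ν hB φ hlam₁
    (isHolder_of_mem_logCone hα (mul_nonneg hC (logHolderFactor_nonneg hα)) hε hfc) hf hfL)
  have hfE := (isEigen_iff_transfer ν hB.isClopen φ f lam).2 hfL
  have hpt : ∀ z, φ z + Real.log (f z) - Real.log (f (shift z))
      ≤ Real.log lam + C * κ + -Real.log c := fun z => by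
    have hlow : ∀ a ∈ Metric.ball (z.1 0) δ, Real.exp (φ z - C * κ) * f z
        ≤ extCons (fun w => Real.exp (φ w) * f w) a (shift z) := fun a ha => by
      have ha' : A a ((shift z).1 0) ∈ I := by
        have h1 : secSet (transpose A) I a = secSet (transpose A) I (z.1 0) :=
          hsec _ _ ((Metric.mem_ball.1 ha).trans_le hδδ₁)
        have h2 : (shift z).1 0 ∈ secSet (transpose A) I a := by rw [h1]; exact z.2 0
        exact h2
      rw [extCons_of_mem _ ha']
      set w := cons a (shift z) ha' with hw
      have hd : seqDist z w = dist (z.1 0) a / 2 := by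
        have h1 := seqDist_cons_cons (z.1 0) a (shift z) (shift z) (z.2 0) ha'
        rwa [cons_shift, seqDist_self, add_zero] at h1
      have hd0 := seqDist_nonneg z w
      have hdδ : seqDist z w < δ := by
        rw [hd, dist_comm]
        have := Metric.mem_ball.1 ha
        linarith
      have hdα : seqDist z w ^ α ≤ δ₂ ^ α :=
        Real.rpow_le_rpow hd0 (hdδ.le.trans (min_le_right _ _)) hα.le
      have h1 := hfc.2 z w (hdδ.trans_le hδε)
      have h2 := (le_abs_self _).trans (hφ z w)
      have h3 : C * logHolderFactor α * seqDist z w ^ α + C * seqDist z w ^ α ≤ C * κ := by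
        have h4 : C * ((1 + logHolderFactor α) * seqDist z w ^ α) ≤ C * κ :=
          mul_le_mul_of_nonneg_left ((mul_le_mul_of_nonneg_left hdα
            (add_nonneg zero_le_one (logHolderFactor_nonneg hα))).trans hδκ) hC
        linarith
      calc Real.exp (φ z - C * κ) * f z
          ≤ Real.exp (φ z - C * κ) *
            (Real.exp (C * logHolderFactor α * seqDist z w ^ α) * f w) :=
            mul_le_mul_of_nonneg_left h1 (Real.exp_pos _).le
        _ = Real.exp (φ z - C * κ + C * logHolderFactor α * seqDist z w ^ α) * f w := by
            rw [Real.exp_add]; ring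
        _ ≤ Real.exp (φ w) * f w :=
            mul_le_mul_of_nonneg_right (Real.exp_le_exp.2 (by linarith)) (hf w).le
    have hint := integrable_extCons ν hB.isClopen
      (g := fun w => Real.exp (φ w) * f w) (by fun_prop) (shift z)
    have h1 : c * (Real.exp (φ z - C * κ) * f z) ≤ lam * f (shift z) := by
      rw [← hfE (shift z), ruelle_eq_integral ν hB.isClopen]
      calc c * (Real.exp (φ z - C * κ) * f z)
          ≤ ν.real (Metric.ball (z.1 0) δ) * (Real.exp (φ z - C * κ) * f z) :=
            mul_le_mul_of_nonneg_right (hball _) (mul_pos (Real.exp_pos _) (hf z)).le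
        _ = ∫ a in Metric.ball (z.1 0) δ, Real.exp (φ z - C * κ) * f z ∂ν := by
            rw [setIntegral_const, smul_eq_mul]
        _ ≤ ∫ a in Metric.ball (z.1 0) δ,
              extCons (fun w => Real.exp (φ w) * f w) a (shift z) ∂ν :=
            setIntegral_mono_on (integrable_const _) hint.integrableOn
              Metric.isOpen_ball.measurableSet hlow
        _ ≤ _ := setIntegral_le_integral hint (Eventually.of_forall fun a =>
            extCons_nonneg (fun w => (mul_pos (Real.exp_pos _) (hf w)).le) a _)
    have h2 := Real.log_le_log (mul_pos hc (mul_pos (Real.exp_pos _) (hf z))) h1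
    rw [Real.log_mul hc.ne' (mul_pos (Real.exp_pos _) (hf z)).ne',
      Real.log_mul (Real.exp_pos _).ne' (hf z).ne', Real.log_exp,
      Real.log_mul hlam.pos.ne' (hf _).ne'] at h2
    linarith
  have hlogc : Continuous fun z => Real.log (f z) := f.continuous.log fun z => (hf z).ne'
  have hlogs : Continuous fun z => Real.log (f (shift z)) := hlogc.comp continuous_shift
  have hsh : ∫ z, Real.log (f (shift z)) ∂μ = ∫ z, Real.log (f z) ∂μ := by
    conv_rhs => rw [← hinv.map_eq]
    exact (integral_map continuous_shift.measurable.aemeasurable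
      hlogc.aestronglyMeasurable).symm
  have hfin : ∫ z, (φ z + Real.log (f z) - Real.log (f (shift z))) ∂μ
      ≤ ∫ z, (Real.log lam + C * κ + -Real.log c) ∂μ :=
    integral_mono (integrable_of_continuous (by fun_prop)) (integrable_const _) hpt
  rw [integral_sub (integrable_of_continuous (by fun_prop)) (integrable_of_continuous hlogs),
    integral_add (integrable_of_continuous (by fun_prop)) (integrable_of_continuous hlogc), hsh,
    integral_const, probReal_univ, one_smul] at hfin
  linarith

end Pressure

/-! ### The zero temperature limit -/

section ZeroTemperature

variable {M : Type*} [MetricSpace M] [CompactSpace M] [MeasurableSpace M] [BorelSpace M]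
  (ν : Measure M) [IsProbabilityMeasure ν] [ν.IsOpenPosMeasure] {A : M → M → ℝ} {I : Set ℝ}
  [CompactSpace (Adm A I)] [CompactSpace (Adm (transpose A) I)]

/-- The tangent at `t` to the pressure `t ↦ log lam_t`, with slope `∫ φ̂ dm`, lies below the
pressure at `1`. The marginal of `m` on `B` is invariant. -/
lemma IsBilateralGibbs.log_add_integral_le (hB : IsIrreducibleSubshift A I)
    (hB' : IsIrreducibleSubshift (transpose A) I)
    (hext : ∀ y : Adm (transpose A) I, ∃ x : Adm A I, A (y.1 0) (x.1 0) ∈ I) {α : ℝ} (hα : 0 < α)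
    {φ : C(Adm A I, ℝ)} {φ' : C(Adm (transpose A) I, ℝ)} {W : Hat A I → ℝ} (hW : Continuous W)
    (hdual : IsInvolutionKernel φ φ' W) {t lam₁ : ℝ} {m : Measure (Hat A I)}
    (hlam₁ : IsMaximalEigenvalue ν α φ lam₁)
    (hm : IsBilateralGibbs ν α (fun x => t * φ x) (fun y => t * φ' y) (fun p => t * W p) m) :
    (∃ lam, IsMaximalEigenvalue ν α (fun x => t * φ x) lam ∧
      Real.log lam + (1 - t) * ∫ p, φ p.1.2 ∂m ≤ Real.log lam₁) ∧
    ∀ ψ : C(Adm A I, ℝ), ∫ p, ψ (shift p.1.2) ∂m = ∫ p, ψ p.1.2 ∂m := by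
  obtain ⟨lam, lam', ρ, ρ', hlam, -, hρ, hρ', rfl⟩ := hm
  have hd : IsInvolutionKernel (fun x => t * φ x) (fun y => t * φ' y) fun p => t * W p :=
    fun p => by simp only [hdual p]; ring
  obtain ⟨⟨hfc, hf, hfL, hf1⟩, -, rfl, -, hψ, -⟩ := bilateral_eigenfunctions ν hB hB' hext
    (by fun_prop) (by fun_prop) (by fun_prop : Continuous fun p => t * W p) hd hρ hρ'
  obtain ⟨f₁, hf₁α, hf₁, hf₁L⟩ := hlam₁.exists_eigenfunction
  refine ⟨⟨lam, hlam, ?_⟩, fun ψ => ?_⟩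
  · have h := log_add_integral_le_log ν (φ := φ) (χ := t • φ) hlam.pos hρ hfc hf hfL hf1
      hlam₁.pos (hf₁α.continuous hα) hf₁ hf₁L
    rw [hψ φ, ← integral_const_mul]
    refine le_trans (le_of_eq ?_) h
    congr 1
    refine integral_congr_ae (Eventually.of_forall fun x => ?_)
    simp only [ContinuousMap.smul_apply, smul_eq_mul]
    ring
  · have h1 := hψ ⟨fun x => ψ (shift x), by fun_prop⟩
    simp only [ContinuousMap.coe_mk] at h1
    rw [h1, hψ ψ]
    exact integral_comp_shift_mul ν hlam.pos.ne' hρ hfc hfL ψ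

/-- Accumulation points of the bilateral Gibbs measures at zero temperature maximize the integral
of `φ̂`: by convexity of the pressure, `∫ φ̂ dm_t` is at least the slope of the chord over `[1, t]`,
and the pressure at `t` is at least `t ∫ φ dμ - o(t)` for every invariant `μ`. -/
theorem isLUB_integral_of_mapClusterPt (hB : IsIrreducibleSubshift A I)
    (hB' : IsIrreducibleSubshift (transpose A) I)
    (hext : ∀ y : Adm (transpose A) I, ∃ x : Adm A I, A (y.1 0) (x.1 0) ∈ I) {α : ℝ} (hα : 0 < α)
    {φ : Adm A I → ℝ} {φ' : Adm (transpose A) I → ℝ} {W : Hat A I → ℝ}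
    (hφ : IsHolder seqDist α φ) (hφ' : Continuous φ') (hW : Continuous W)
    (hdual : IsInvolutionKernel φ φ' W) {m : ℝ → ProbabilityMeasure (Hat A I)}
    (hm : ∀ t : ℝ, 1 < t → IsBilateralGibbs ν α (fun x => t * φ x) (fun y => t * φ' y)
      (fun p => t * W p) (m t : Measure (Hat A I)))
    {mInf : ProbabilityMeasure (Hat A I)} (hcl : MapClusterPt mInf atTop m) :
    IsLUB (invariantIntegrals φ) (∫ p, φ p.1.2 ∂(mInf : Measure (Hat A I))) := by
  have hHat : CompactSpace (Hat A I) :=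
    isCompact_iff_compactSpace.1 (isClopen_admissible_pairs hB.isClopen).1.isCompact
  obtain ⟨C, hC, hφC⟩ := hφ.exists_nonneg seqDist_nonneg
  obtain ⟨lam₁, -, -, hlam₁, -, -⟩ := exists_eigenvalue_eigenprobability_gibbs ν hB hα hφ
  let Φ : C(Adm A I, ℝ) := ⟨φ, hφ.continuous hα⟩
  have hpack := fun t ht => (hm t ht).log_add_integral_le ν hB hB' hext hα (φ := Φ)
    (φ' := ⟨φ', hφ'⟩) hW hdual hlam₁
  obtain ⟨U, hU, hlim⟩ := mapClusterPt_iff_ultrafilter.1 hcl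
  have hsnd : Continuous fun p : Hat A I => p.1.2 := continuous_snd.comp continuous_subtype_val
  have hint : ∀ ψ : C(Adm A I, ℝ), Tendsto (fun t => ∫ p, ψ p.1.2 ∂(m t : Measure (Hat A I))) U
      (𝓝 (∫ p, ψ p.1.2 ∂(mInf : Measure (Hat A I)))) := fun ψ =>
    ((ProbabilityMeasure.continuous_integral_continuousMap
      (⟨fun p => ψ p.1.2, ψ.continuous.comp hsnd⟩ : C(Hat A I, ℝ))).tendsto mInf).comp hlim
  refine ⟨?_, fun b hb => ?_⟩
  · rintro _ ⟨μ, hμ, hinv, rfl⟩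
    refine le_of_forall_pos_sub_le fun κ hκ => ge_of_tendsto (hint Φ) (hU ?_)
    have hκ' : 0 < κ / 2 / (C + 1) := by positivity
    obtain ⟨b, hb⟩ := exists_integral_le_log_add ν hB hB'.locallyConstant hα hκ'
    have hCκ : C * (κ / 2 / (C + 1)) ≤ κ / 2 := by
      rw [mul_div_assoc', div_le_iff₀ (by positivity)]
      nlinarith
    set a := ∫ x, φ x ∂μ with ha
    filter_upwards [eventually_gt_atTop 1, eventually_ge_atTop
      (2 * (κ + b + Real.log lam₁ - a) / κ)] with t ht ht'
    obtain ⟨⟨lam, hlam, hle⟩, -⟩ := hpack t ht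
    have h1 := hb (t • Φ) (t * C) lam (by positivity) (fun x y => by
      show |t * φ x - t * φ y| ≤ _
      rw [← mul_sub, abs_mul, abs_of_pos (by linarith), mul_assoc]
      exact mul_le_mul_of_nonneg_left (hφC x y) (by linarith)) hlam μ hμ hinv
    have h2 : ∫ x, (t • Φ) x ∂μ = t * a := by
      rw [ha, ← integral_const_mul]; rfl
    rw [h2] at h1
    set s := ∫ p, Φ p.1.2 ∂(m t : Measure (Hat A I)) with hs
    have h3 : t * C * (κ / 2 / (C + 1)) ≤ t * (κ / 2) := by
      rw [mul_assoc]; exact mul_le_mul_of_nonneg_left hCκ (by linarith)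
    rw [div_le_iff₀ hκ] at ht'
    have h4 : (t - 1) * (a - κ) ≤ (t - 1) * s := by linarith
    exact le_of_mul_le_mul_left h4 (by linarith)
  · refine hb ⟨(mInf : Measure (Hat A I)).map fun p => p.1.2,
      Measure.isProbabilityMeasure_map hsnd.measurable.aemeasurable, ?_, ?_⟩
    · have hprob : IsProbabilityMeasure ((mInf : Measure (Hat A I)).map fun p => p.1.2) :=
        Measure.isProbabilityMeasure_map hsnd.measurable.aemeasurable
      have hsh : Measurable (shift : Adm A I → Adm A I) := continuous_shift.measurable
      have hprob' := Measure.isProbabilityMeasure_map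
        (μ := (mInf : Measure (Hat A I)).map fun p => p.1.2) hsh.aemeasurable
      refine ⟨hsh, ext_of_forall_integral_eq_of_IsFiniteMeasure fun ψ => ?_⟩
      have hψs : Continuous fun x : Adm A I => ψ (shift x) := by fun_prop
      rw [integral_map hsh.aemeasurable ψ.continuous.aestronglyMeasurable,
        integral_map hsnd.measurable.aemeasurable hψs.aestronglyMeasurable,
        integral_map hsnd.measurable.aemeasurable ψ.continuous.aestronglyMeasurable]
      have h1 := hint ⟨fun x => ψ (shift x), hψs⟩
      have h2 := hint ψ.toContinuousMap
      refine tendsto_nhds_unique h1 (h2.congr' (hU ?_))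
      filter_upwards [eventually_gt_atTop 1] with t ht
      exact ((hpack t ht).2 ψ.toContinuousMap).symm
    · exact (integral_map hsnd.measurable.aemeasurable
        Φ.continuous.aestronglyMeasurable).symm

end ZeroTemperature

end InvolutionKernel

theorem theorem4 {M : Type*} [MetricSpace M] [CompactSpace M] [MeasurableSpace M] [BorelSpace M]
    (ν : Measure M) [IsProbabilityMeasure ν] [ν.IsOpenPosMeasure]
    (A : M → M → ℝ) (hA : Continuous (Function.uncurry A)) (I : Set ℝ) (hI : IsCompact I)
    (hs : IsLocallyConstant (InvolutionKernel.secSet A I))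
    (hs' : IsLocallyConstant (InvolutionKernel.secSet (InvolutionKernel.transpose A) I))
    (hne : Nonempty (InvolutionKernel.Adm A I))
    (htrans : InvolutionKernel.IsTransitive A I)
    (hext : ∀ y : InvolutionKernel.Adm (InvolutionKernel.transpose A) I,
      ∃ x : InvolutionKernel.Adm A I, A (y.1 0) (x.1 0) ∈ I)
    (α : ℝ) (hα : 0 < α)
    (φ : InvolutionKernel.Adm A I → ℝ)
    (φ' : InvolutionKernel.Adm (InvolutionKernel.transpose A) I → ℝ)
    (W : InvolutionKernel.Hat A I → ℝ)
    (hφ : InvolutionKernel.IsHolder InvolutionKernel.seqDist α φ)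
    (hφ' : InvolutionKernel.IsHolder InvolutionKernel.seqDist α φ')
    (hW : InvolutionKernel.IsHolder InvolutionKernel.hatDist α W)
    (hdual : InvolutionKernel.IsInvolutionKernel φ φ' W) :
    -- the objects `λ`, `ρ`, `μ` exist for `φ` and for `φ'`
    (∃ lam ρ μ, InvolutionKernel.IsMaximalEigenvalue ν α φ lam ∧
      InvolutionKernel.IsEigenprobability ν φ lam ρ ∧ InvolutionKernel.IsGibbsState ν α φ μ) ∧
    (∃ lam' ρ' μ', InvolutionKernel.IsMaximalEigenvalue ν α φ' lam' ∧
      InvolutionKernel.IsEigenprobability ν φ' lam' ρ' ∧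
      InvolutionKernel.IsGibbsState ν α φ' μ') ∧
    (∀ (lam lam' : ℝ) (ρ : Measure (InvolutionKernel.Adm A I))
      (ρ' : Measure (InvolutionKernel.Adm (InvolutionKernel.transpose A) I)),
      InvolutionKernel.IsMaximalEigenvalue ν α φ lam →
      InvolutionKernel.IsMaximalEigenvalue ν α φ' lam' →
      InvolutionKernel.IsEigenprobability ν φ lam ρ →
      InvolutionKernel.IsEigenprobability ν φ' lam' ρ' →
      -- the eigenfunctions
      (Continuous (InvolutionKernel.eigenfun W ρ' ρ) ∧
        InvolutionKernel.IsEigen ν φ lam (InvolutionKernel.eigenfun W ρ' ρ) ∧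
        ∫ x, InvolutionKernel.eigenfun W ρ' ρ x ∂ρ = 1 ∧
        Continuous (InvolutionKernel.eigenfunStar W ρ' ρ) ∧
        InvolutionKernel.IsEigen ν φ' lam' (InvolutionKernel.eigenfunStar W ρ' ρ) ∧
        ∫ y, InvolutionKernel.eigenfunStar W ρ' ρ y ∂ρ' = 1 ∧
        lam = lam') ∧
      -- the natural extension
      (IsProbabilityMeasure (InvolutionKernel.bilateralMeasure W ρ' ρ) ∧
        (∀ μ, InvolutionKernel.IsGibbsState ν α φ μ →
          ∀ ψ : C(InvolutionKernel.Adm A I, ℝ),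
            ∫ p, ψ p.1.2 ∂(InvolutionKernel.bilateralMeasure W ρ' ρ) = ∫ x, ψ x ∂μ) ∧
        (∀ μ', InvolutionKernel.IsGibbsState ν α φ' μ' →
          ∀ ψ : C(InvolutionKernel.Adm (InvolutionKernel.transpose A) I, ℝ),
            ∫ p, ψ p.1.1 ∂(InvolutionKernel.bilateralMeasure W ρ' ρ) = ∫ y, ψ y ∂μ'))) ∧
    -- accumulation points at zero temperature
    (∀ m : ℝ → ProbabilityMeasure (InvolutionKernel.Hat A I),
      (∀ t : ℝ, 1 < t → InvolutionKernel.IsBilateralGibbs ν α (fun x => t * φ x)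
        (fun y => t * φ' y) (fun p => t * W p) (m t : Measure (InvolutionKernel.Hat A I))) →
      ∀ mInf : ProbabilityMeasure (InvolutionKernel.Hat A I),
        MapClusterPt mInf atTop m →
        IsLUB (InvolutionKernel.invariantIntegrals φ)
          (∫ p, φ p.1.2 ∂(mInf : Measure (InvolutionKernel.Hat A I)))) := by
  have hR := InvolutionKernel.isClopen_of_isLocallyConstant hA hI.isClosed hs hs'
  have hB := htrans.isIrreducibleSubshift hne hR hs
  have hB' := hB.transpose hs' hext
  have hX := InvolutionKernel.compactSpace_adm hR
  have hY := InvolutionKernel.compactSpace_adm hB'.isClopen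
  refine ⟨InvolutionKernel.exists_eigenvalue_eigenprobability_gibbs ν hB hα hφ,
    InvolutionKernel.exists_eigenvalue_eigenprobability_gibbs ν hB' hα hφ',
    fun lam lam' ρ ρ' hlam hlam' hρ hρ' => ?_, fun m hm mInf hcl =>
    InvolutionKernel.isLUB_integral_of_mapClusterPt ν hB hB' hext hα hφ (hφ'.continuous hα)
      (hW.continuous_hat hα) hdual hm hcl⟩
  obtain ⟨⟨hfc, hf, hfL, hf1⟩, ⟨hgc, hg, hgL, hg1⟩, rfl, hprob, hψ, hψ'⟩ :=
    InvolutionKernel.bilateral_eigenfunctions ν hB hB' hext (hφ.continuous hα)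
      (hφ'.continuous hα) (hW.continuous_hat hα) hdual hρ hρ'
  refine ⟨⟨hfc, hfL, hf1, hgc, hgL, hg1, rfl⟩, hprob, fun μ hμ ψ => ?_, fun μ' hμ' ψ => ?_⟩
  · rw [hψ ψ]
    exact hμ.integral_eq ν hB hα hφ hlam hρ hfc hfL hf1 ψ
  · rw [hψ' ψ]
    exact hμ'.integral_eq ν hB' hα hφ' hlam' hρ' hgc hgL hg1 ψ
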